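/- Let $M$ be a compact smooth manifold of real dimension $4$ without boundary (not necessarily connected), let $g$ be a smooth Riemannian metric on $M$, and let $J$ be a smooth almost complex structure on $M$ ($J^2=-\mathrm{Id}$) which is $g$-orthogonal, i.e. $g(JX,JY)=g(X,Y)$. Let $\omega(X,Y)=g(JX,Y)$ be the fundamental $2$-form, and let $\theta$ be the Lee form, $\theta = J\delta\omega$ (equivalently, $d\omega=\theta\wedge\omega$), where $\delta$ is the codifferential of $g$ and $(J\alpha)(X)=-\alpha(JX)$ for a $1$-form $\alpha$. Let $R$ be the Riemannian curvature tensor and $s$ the scalar curvature of $g$. Assume that $(M,g,J,\omega)$ is of class $\mathcal{AH}_1$, that is, that it satisfies the first Gray curvature condition $$R(X,Y,Z,W)=R(X,Y,JZ,JW)$$ for all $p\in M$ and all $X,Y,Z,W\in T_pM$, and assume that $s(p)\neq 0$ for every $p\in M$. Then $\delta\theta=0$ on $M$, i.e. the almost Hermitian structure is Gauduchon. -/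

import Mathlib

open scoped Manifold ContDiff

noncomputable section

/-- The model space `ℝ⁴`. -/
abbrev R4 : Type := EuclideanSpace ℝ (Fin 4)

/-! ### Tensor calculus in local coordinates

Here `G` is the matrix-valued function `y ↦ (g_{ij}(y))` of the components of a Riemannian metric
in a coordinate system on an open subset of `ℝ⁴`, and `A` is the matrix-valued function
`y ↦ (J^i_j(y))` of the components of an endomorphism field (`J ∂_j = ∑ i, J^i_j ∂_i`), with the
upper index as row index. -/

namespace Coord

/-- The partial derivative `∂_i f`. -/
def pderiv (i : Fin 4) (f : R4 → ℝ) (y : R4) : ℝ :=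
  fderiv ℝ f y (EuclideanSpace.single i 1)

/-- Christoffel symbols of the Levi-Civita connection, `∇_{∂_i} ∂_j = ∑ k, Γ^k_{ij} ∂_k`:
`Γ^k_{ij} = ½ ∑ l, g^{kl} (∂_i g_{jl} + ∂_j g_{il} - ∂_l g_{ij})`. -/
def christoffel (G : R4 → Matrix (Fin 4) (Fin 4) ℝ) (k i j : Fin 4) (y : R4) : ℝ :=
  (1 / 2) * ∑ l, (G y)⁻¹ k l *
    (pderiv i (fun z => G z j l) y + pderiv j (fun z => G z i l) y
      - pderiv l (fun z => G z i j) y)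

/-- The curvature `R(X, Y) Z = ∇_X ∇_Y Z - ∇_Y ∇_X Z - ∇_{[X, Y]} Z` in components:
`R(∂_i, ∂_j) ∂_k = ∑ l, (curvature G i j k l) ∂_l`. -/
def curvature (G : R4 → Matrix (Fin 4) (Fin 4) ℝ) (i j k l : Fin 4) (y : R4) : ℝ :=
  pderiv i (christoffel G l j k) y - pderiv j (christoffel G l i k) y
    + ∑ m, (christoffel G l i m y * christoffel G m j k y
      - christoffel G l j m y * christoffel G m i k y)

/-- The `(0, 4)` curvature tensor `R_{ijkl} = g(R(∂_i, ∂_j) ∂_k, ∂_l)`. -/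
def riemann (G : R4 → Matrix (Fin 4) (Fin 4) ℝ) (i j k l : Fin 4) (y : R4) : ℝ :=
  ∑ m, curvature G i j k m y * G y m l

/-- The Ricci tensor `Ric(∂_j, ∂_k) = tr (X ↦ R(X, ∂_j) ∂_k)`. -/
def ricci (G : R4 → Matrix (Fin 4) (Fin 4) ℝ) (j k : Fin 4) (y : R4) : ℝ :=
  ∑ i, curvature G i j k i y

/-- The scalar curvature `s = ∑ g^{jk} Ric_{jk}`. -/
def scalar (G : R4 → Matrix (Fin 4) (Fin 4) ℝ) (y : R4) : ℝ :=
  ∑ j, ∑ k, (G y)⁻¹ j k * ricci G j k y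

/-- The covariant derivative of a 1-form, `(∇_{∂_i} α)(∂_j)`. -/
def nablaOne (G : R4 → Matrix (Fin 4) (Fin 4) ℝ) (α : Fin 4 → R4 → ℝ)
    (i j : Fin 4) (y : R4) : ℝ :=
  pderiv i (α j) y - ∑ k, christoffel G k i j y * α k y

/-- The covariant derivative of a covariant 2-tensor, `(∇_{∂_i} β)(∂_j, ∂_k)`. -/
def nablaTwo (G : R4 → Matrix (Fin 4) (Fin 4) ℝ) (β : Fin 4 → Fin 4 → R4 → ℝ)
    (i j k : Fin 4) (y : R4) : ℝ :=
  pderiv i (β j k) y - ∑ m, christoffel G m i j y * β m k y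
    - ∑ m, christoffel G m i k y * β j m y

/-- The codifferential of a 1-form, `δα = - ∑ g^{ij} (∇_{∂_i} α)(∂_j)`. -/
def codiffOne (G : R4 → Matrix (Fin 4) (Fin 4) ℝ) (α : Fin 4 → R4 → ℝ) (y : R4) : ℝ :=
  - ∑ i, ∑ j, (G y)⁻¹ i j * nablaOne G α i j y

/-- The codifferential of a 2-form, `(δβ)(∂_k) = - ∑ g^{ij} (∇_{∂_i} β)(∂_j, ∂_k)`. -/
def codiffTwo (G : R4 → Matrix (Fin 4) (Fin 4) ℝ) (β : Fin 4 → Fin 4 → R4 → ℝ)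
    (k : Fin 4) (y : R4) : ℝ :=
  - ∑ i, ∑ j, (G y)⁻¹ i j * nablaTwo G β i j k y

/-- The fundamental form `ω(∂_i, ∂_j) = g(J ∂_i, ∂_j)`. -/
def fundamentalForm (G A : R4 → Matrix (Fin 4) (Fin 4) ℝ) (i j : Fin 4) (y : R4) : ℝ :=
  ∑ k, A y k i * G y k j

/-- The Lee form `θ = J δω`, where `(J α)(X) = - α(J X)` for a 1-form `α`. -/
def leeForm (G A : R4 → Matrix (Fin 4) (Fin 4) ℝ) (i : Fin 4) (y : R4) : ℝ :=
  - ∑ k, A y k i * codiffTwo G (fundamentalForm G A) k y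

end Coord

/-! ### Almost Hermitian 4-manifolds -/

/-- An almost Hermitian structure on a smooth 4-manifold: a smooth Riemannian metric `g` and a
smooth `g`-orthogonal almost complex structure `J`. -/
structure AlmostHermitian (M : Type*) [TopologicalSpace M] [ChartedSpace R4 M]
    [IsManifold 𝓘(ℝ, R4) ∞ M] where
  /-- the Riemannian metric -/
  g : Bundle.ContMDiffRiemannianMetric 𝓘(ℝ, R4) ∞ R4
    (fun x : M => TangentSpace 𝓘(ℝ, R4) x)
  /-- the almost complex structure -/
  J : ∀ x : M, TangentSpace 𝓘(ℝ, R4) x →L[ℝ] TangentSpace 𝓘(ℝ, R4) x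
  smooth_J : ContMDiff 𝓘(ℝ, R4) (𝓘(ℝ, R4).prod 𝓘(ℝ, R4 →L[ℝ] R4)) ∞
    (fun x : M => Bundle.TotalSpace.mk' (R4 →L[ℝ] R4)
      (E := fun x : M => TangentSpace 𝓘(ℝ, R4) x →L[ℝ] TangentSpace 𝓘(ℝ, R4) x) x (J x))
  J_sq : ∀ (x : M) (v : TangentSpace 𝓘(ℝ, R4) x), J x (J x v) = -v
  J_orthogonal : ∀ (x : M) (v w : TangentSpace 𝓘(ℝ, R4) x),
    g.inner x (J x v) (J x w) = g.inner x v w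

namespace AlmostHermitian

variable {M : Type*} [TopologicalSpace M] [ChartedSpace R4 M] [IsManifold 𝓘(ℝ, R4) ∞ M]

/-- The coordinate vector field `∂_i` of the chart `e`, at the point with coordinates `y`. -/
def coordVector (e : OpenPartialHomeomorph M R4) (y : R4) (i : Fin 4) :
    TangentSpace 𝓘(ℝ, R4) (e.symm y) :=
  mfderiv 𝓘(ℝ, R4) 𝓘(ℝ, R4) e.symm y (EuclideanSpace.single i (1 : ℝ) : R4)

/-- The components `g_{ij} = g(∂_i, ∂_j)` of the metric in the chart `e`. -/
def metricMatrix (S : AlmostHermitian M) (e : OpenPartialHomeomorph M R4) (y : R4) :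
    Matrix (Fin 4) (Fin 4) ℝ :=
  Matrix.of fun i j => S.g.inner (e.symm y) (coordVector e y i) (coordVector e y j)

/-- The components `J^i_j = dx^i (J ∂_j)` of the almost complex structure in the chart `e`. -/
def complexMatrix (S : AlmostHermitian M) (e : OpenPartialHomeomorph M R4) (y : R4) :
    Matrix (Fin 4) (Fin 4) ℝ :=
  Matrix.of fun i j =>
    (EuclideanSpace.proj i : R4 →L[ℝ] ℝ)
      (mfderiv 𝓘(ℝ, R4) 𝓘(ℝ, R4) e (e.symm y) (S.J (e.symm y) (coordVector e y j)))

/-- The scalar curvature in the chart `e`, as a function of the coordinates. -/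
def scalarCurvature (S : AlmostHermitian M) (e : OpenPartialHomeomorph M R4) (y : R4) : ℝ :=
  Coord.scalar (S.metricMatrix e) y

/-- The components of the Lee form `θ = J δω` in the chart `e`. -/
def leeForm (S : AlmostHermitian M) (e : OpenPartialHomeomorph M R4) (i : Fin 4) (y : R4) : ℝ :=
  Coord.leeForm (S.metricMatrix e) (S.complexMatrix e) i y

/-- The codifferential `δθ` of the Lee form in the chart `e`, as a function of the coordinates. -/
def codiffLee (S : AlmostHermitian M) (e : OpenPartialHomeomorph M R4) (y : R4) : ℝ :=
  Coord.codiffOne (S.metricMatrix e) (S.leeForm e) y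

/-- The first Gray condition `R(X, Y, Z, W) = R(X, Y, JZ, JW)`, in every chart of the atlas and for
the coordinate vectors at every point of the chart. -/
def IsAH1 (S : AlmostHermitian M) : Prop :=
  ∀ e ∈ atlas R4 M, ∀ y ∈ e.target, ∀ i j k l : Fin 4,
    Coord.riemann (S.metricMatrix e) i j k l y =
      ∑ m, ∑ n, S.complexMatrix e y m k * S.complexMatrix e y n l *
        Coord.riemann (S.metricMatrix e) i j m n y

end AlmostHermitian

end

/-!
The theorem comes from two 2-forms on `M`, `β(X, Y) = tr (J ∇_X J ∇_Y J)` and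
`ρ(X, Y) = tr (J R(X, Y))`.

The first Gray condition says that the curvature endomorphisms commute with `J`. Hence
`∇²_{X,Y} J` is symmetric in `X` and `Y`, and both forms are closed. In dimension 4, the commutator
of two endomorphisms which anticommute with `J` is a multiple of `J`, and the commutator of one
which commutes with one which anticommutes with `J` is a multiple of `J` times the latter. This
gives `δθ = -¼ q` with `q = ⟨β, ω⟩`, while the Bianchi identity gives `r := ⟨ρ, ω⟩ = -2 s`. Applying
`R` to `∇J` and antisymmetrizing gives `ρ ∧ J ∇J = 0`, hence `r β = q ρ`, and `ρ(X, ·) = 0` for the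
vector field `X` dual to `θ`. The exterior derivative of `r β = q ρ`, contracted with `X`, yields
`r X(q) = q X(r)`: the function `f = q / |r|` is constant along `X`.

Since `div X = -δθ = ¼ q`, the integral of `X(v) + ¼ v q` vanishes for every smooth `v`, by the
divergence theorem. For `v = f` the integrand is `¼ q² / |r|`, so `q = 0`.
-/

noncomputable section

/-! ### Matrix-valued functions on open subsets of `ℝ⁴` -/

namespace Coord

open scoped Matrix

section PartialDerivatives

variable {T : Set R4} {f h : R4 → ℝ} {y : R4}

theorem pderiv_congr {i : Fin 4} (hT : IsOpen T) (hy : y ∈ T) (hfh : Set.EqOn f h T) :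
    pderiv i f y = pderiv i h y := by
  unfold pderiv
  rw [(hfh.eventuallyEq_of_mem (hT.mem_nhds hy)).fderiv_eq]

theorem differentiableAt_of_contDiffOn (hT : IsOpen T) (hf : ContDiffOn ℝ ∞ f T) (hy : y ∈ T) :
    DifferentiableAt ℝ f y :=
  (hf.contDiffAt (hT.mem_nhds hy)).differentiableAt (by simp)

theorem contDiffOn_pderiv (hT : IsOpen T) (hf : ContDiffOn ℝ ∞ f T) (i : Fin 4) :
    ContDiffOn ℝ ∞ (pderiv i f) T :=
  (hf.fderiv_of_isOpen hT (by simp)).clm_apply contDiffOn_const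

theorem pderiv_const (i : Fin 4) (c : ℝ) : pderiv i (fun _ => c) y = 0 := by
  simp [pderiv]

theorem pderiv_add (i : Fin 4) (hf : DifferentiableAt ℝ f y) (hh : DifferentiableAt ℝ h y) :
    pderiv i (fun z => f z + h z) y = pderiv i f y + pderiv i h y := by
  simp only [pderiv, fderiv_fun_add hf hh, add_apply]

theorem pderiv_sub (i : Fin 4) (hf : DifferentiableAt ℝ f y) (hh : DifferentiableAt ℝ h y) :
    pderiv i (fun z => f z - h z) y = pderiv i f y - pderiv i h y := by
  simp only [pderiv, fderiv_fun_sub hf hh, sub_apply]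

theorem pderiv_mul (i : Fin 4) (hf : DifferentiableAt ℝ f y) (hh : DifferentiableAt ℝ h y) :
    pderiv i (fun z => f z * h z) y = pderiv i f y * h y + f y * pderiv i h y := by
  simp only [pderiv, fderiv_fun_mul hf hh, add_apply, smul_apply, smul_eq_mul]
  ring

theorem pderiv_sum {ι : Type*} (s : Finset ι) (i : Fin 4) {u : ι → R4 → ℝ}
    (hu : ∀ j ∈ s, DifferentiableAt ℝ (u j) y) :
    pderiv i (fun z => ∑ j ∈ s, u j z) y = ∑ j ∈ s, pderiv i (u j) y := by
  simp only [pderiv, fderiv_fun_sum hu, sum_apply]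

theorem pderiv_prod {ι : Type*} [DecidableEq ι] (s : Finset ι) (i : Fin 4) {u : ι → R4 → ℝ}
    (hu : ∀ j ∈ s, DifferentiableAt ℝ (u j) y) :
    pderiv i (fun z => ∏ j ∈ s, u j z) y =
      ∑ j ∈ s, (∏ k ∈ s.erase j, u k y) * pderiv i (u j) y := by
  simp only [pderiv, (HasFDerivAt.finsetProd fun j hj => (hu j hj).hasFDerivAt).fderiv,
    sum_apply, smul_apply, smul_eq_mul]

theorem pderiv_comm (hT : IsOpen T) (hf : ContDiffOn ℝ ∞ f T) (hy : y ∈ T) (i j : Fin 4) :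
    pderiv i (pderiv j f) y = pderiv j (pderiv i f) y := by
  have hfy : ContDiffAt ℝ ∞ f y := hf.contDiffAt (hT.mem_nhds hy)
  have two_le : (2 : WithTop ℕ∞) ≤ ∞ := WithTop.coe_le_coe.2 le_top
  have hf' : DifferentiableAt ℝ (fderiv ℝ f) y :=
    (hfy.fderiv_right (m := 1) (by simpa only [one_add_one_eq_two])).differentiableAt (by simp)
  have second_fderiv (v w : R4) :
      fderiv ℝ (fun z => fderiv ℝ f z v) y w = fderiv ℝ (fderiv ℝ f) y w v := by
    rw [fderiv_clm_apply hf' (differentiableAt_const _)]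
    simp
  unfold pderiv
  rw [second_fderiv, second_fderiv]
  exact hfy.isSymmSndFDerivAt (by simpa) _ _

end PartialDerivatives

section MatrixFields

variable {m n k : Type*} {T : Set R4} {y : R4}

/-- Smoothness on `T` of a matrix-valued function, entry by entry; it avoids choosing a norm on
matrices. -/
def SmoothOn (F : R4 → Matrix m n ℝ) (T : Set R4) : Prop :=
  ∀ a b, ContDiffOn ℝ ∞ (fun z => F z a b) T

/-- The entrywise partial derivative `∂_i F` of a matrix-valued function. -/
def mderiv (i : Fin 4) (F : R4 → Matrix m n ℝ) (y : R4) : Matrix m n ℝ :=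
  Matrix.of fun a b => pderiv i (fun z => F z a b) y

theorem mderiv_apply (i : Fin 4) (F : R4 → Matrix m n ℝ) (y : R4) (a : m) (b : n) :
    mderiv i F y a b = pderiv i (fun z => F z a b) y := rfl

theorem mderiv_congr {F H : R4 → Matrix m n ℝ} {i : Fin 4} (hT : IsOpen T) (hy : y ∈ T)
    (hFH : Set.EqOn F H T) : mderiv i F y = mderiv i H y := by
  ext a b
  exact pderiv_congr hT hy fun z hz => congr_fun₂ (hFH hz) a b

theorem mderiv_const (i : Fin 4) (C : Matrix m n ℝ) : mderiv i (fun _ => C) y = 0 := by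
  ext a b
  exact pderiv_const i _

theorem mderiv_transpose (i : Fin 4) (F : R4 → Matrix m n ℝ) (y : R4) :
    mderiv i (fun z => (F z)ᵀ) y = (mderiv i F y)ᵀ := rfl

theorem mderiv_neg (i : Fin 4) (F : R4 → Matrix m n ℝ) (y : R4) :
    mderiv i (fun z => -F z) y = -mderiv i F y := by
  ext a b
  simp [mderiv, pderiv]

namespace SmoothOn

variable {F H : R4 → Matrix m n ℝ}

theorem differentiableAt (hT : IsOpen T) (hF : SmoothOn F T) (hy : y ∈ T) (a : m) (b : n) :
    DifferentiableAt ℝ (fun z => F z a b) y :=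
  differentiableAt_of_contDiffOn hT (hF a b) hy

theorem add (hF : SmoothOn F T) (hH : SmoothOn H T) : SmoothOn (fun z => F z + H z) T :=
  fun a b => (hF a b).add (hH a b)

theorem sub (hF : SmoothOn F T) (hH : SmoothOn H T) : SmoothOn (fun z => F z - H z) T :=
  fun a b => (hF a b).sub (hH a b)

theorem neg (hF : SmoothOn F T) : SmoothOn (fun z => -F z) T :=
  fun a b => (hF a b).neg

theorem mul [Fintype n] {K : R4 → Matrix n k ℝ} (hF : SmoothOn F T) (hK : SmoothOn K T) :
    SmoothOn (fun z => F z * K z) T := by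
  intro a b
  simp only [Matrix.mul_apply]
  exact ContDiffOn.sum fun c _ => (hF a c).mul (hK c b)

theorem transpose (hF : SmoothOn F T) : SmoothOn (fun z => (F z)ᵀ) T :=
  fun a b => hF b a

theorem mderiv (hT : IsOpen T) (hF : SmoothOn F T) (i : Fin 4) : SmoothOn (mderiv i F) T :=
  fun a b => contDiffOn_pderiv hT (hF a b) i

end SmoothOn

theorem mderiv_add {F H : R4 → Matrix m n ℝ} (hT : IsOpen T) (hF : SmoothOn F T)
    (hH : SmoothOn H T) (hy : y ∈ T) (i : Fin 4) :
    mderiv i (fun z => F z + H z) y = mderiv i F y + mderiv i H y := by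
  ext a b
  exact pderiv_add i (hF.differentiableAt hT hy a b) (hH.differentiableAt hT hy a b)

theorem mderiv_sub {F H : R4 → Matrix m n ℝ} (hT : IsOpen T) (hF : SmoothOn F T)
    (hH : SmoothOn H T) (hy : y ∈ T) (i : Fin 4) :
    mderiv i (fun z => F z - H z) y = mderiv i F y - mderiv i H y := by
  ext a b
  exact pderiv_sub i (hF.differentiableAt hT hy a b) (hH.differentiableAt hT hy a b)

theorem mderiv_mul [Fintype n] {F : R4 → Matrix m n ℝ} {H : R4 → Matrix n k ℝ} (hT : IsOpen T)
    (hF : SmoothOn F T) (hH : SmoothOn H T) (hy : y ∈ T) (i : Fin 4) :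
    mderiv i (fun z => F z * H z) y = mderiv i F y * H y + F y * mderiv i H y := by
  ext a b
  have dF := hF.differentiableAt hT hy
  have dH := hH.differentiableAt hT hy
  simp only [mderiv_apply, Matrix.mul_apply, Matrix.add_apply]
  rw [pderiv_sum _ _ fun c _ => (dF a c).fun_mul (dH c b), ← Finset.sum_add_distrib]
  exact Finset.sum_congr rfl fun c _ => pderiv_mul i (dF a c) (dH c b)

theorem mderiv_comm {F : R4 → Matrix m n ℝ} (hT : IsOpen T) (hF : SmoothOn F T) (hy : y ∈ T)
    (i j : Fin 4) : mderiv i (mderiv j F) y = mderiv j (mderiv i F) y := by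
  ext a b
  exact pderiv_comm hT (hF a b) hy i j

end MatrixFields

section SquareMatrixFields

variable {n : Type*} [Fintype n] {F : R4 → Matrix n n ℝ} {T : Set R4} {y : R4}

theorem SmoothOn.trace (hF : SmoothOn F T) : ContDiffOn ℝ ∞ (fun z => (F z).trace) T := by
  simp only [Matrix.trace, Matrix.diag]
  exact ContDiffOn.sum fun a _ => hF a a

theorem pderiv_trace (hT : IsOpen T) (hF : SmoothOn F T) (hy : y ∈ T) (i : Fin 4) :
    pderiv i (fun z => (F z).trace) y = (mderiv i F y).trace :=
  pderiv_sum _ _ fun a _ => hF.differentiableAt hT hy a a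

variable [DecidableEq n]

theorem SmoothOn.det (hF : SmoothOn F T) : ContDiffOn ℝ ∞ (fun z => (F z).det) T := by
  simp only [Matrix.det_apply']
  exact ContDiffOn.sum fun σ _ => contDiffOn_const.mul (contDiffOn_prod fun a _ => hF _ _)

theorem SmoothOn.adjugate (hF : SmoothOn F T) : SmoothOn (fun z => (F z).adjugate) T := by
  intro a b
  simp only [Matrix.adjugate_apply]
  refine SmoothOn.det (F := fun z => (F z).updateRow b (Pi.single a 1)) fun c d => ?_
  by_cases hc : c = b
  · subst hc
    simpa using contDiffOn_const
  · simpa [Matrix.updateRow_ne hc] using hF c d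

theorem SmoothOn.inv (hF : SmoothOn F T) (hdet : ∀ z ∈ T, (F z).det ≠ 0) :
    SmoothOn (fun z => (F z)⁻¹) T := by
  intro a b
  simp only [Matrix.inv_def, Ring.inverse_eq_inv', Matrix.smul_apply, smul_eq_mul]
  exact (hF.det.inv hdet).mul (hF.adjugate a b)

theorem trace_adjugate_mul (A D : Matrix n n ℝ) :
    (A.adjugate * D).trace = ∑ b, (A.updateCol b fun a => D a b).det := by
  refine Finset.sum_congr rfl fun b _ => ?_
  rw [← Matrix.cramer_apply, Matrix.cramer_eq_adjugate_mulVec]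
  rfl

/-- Jacobi's formula. -/
theorem pderiv_det (hT : IsOpen T) (hF : SmoothOn F T) (hy : y ∈ T) (i : Fin 4) :
    pderiv i (fun z => (F z).det) y = ((F y).adjugate * mderiv i F y).trace := by
  have dF := hF.differentiableAt hT hy
  have dprod (σ : Equiv.Perm n) : DifferentiableAt ℝ (fun z => ∏ a, F z (σ a) a) y :=
    (HasFDerivAt.finsetProd fun a _ => (dF (σ a) a).hasFDerivAt).differentiableAt
  simp only [trace_adjugate_mul, Matrix.det_apply']
  rw [pderiv_sum _ _ fun σ _ => (differentiableAt_const _).fun_mul (dprod σ), Finset.sum_comm]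
  refine Finset.sum_congr rfl fun σ _ => ?_
  rw [pderiv_mul _ (differentiableAt_const _) (dprod σ), pderiv_const, zero_mul, zero_add,
    pderiv_prod _ _ fun a _ => dF (σ a) a, Finset.mul_sum]
  refine Finset.sum_congr rfl fun b _ => ?_
  rw [← Finset.mul_prod_erase _ _ (Finset.mem_univ b), Matrix.updateCol_self,
    mul_comm (∏ _ ∈ _, _)]
  congr 2
  exact Finset.prod_congr rfl fun a ha => by
    rw [Matrix.updateCol_ne (Finset.ne_of_mem_erase ha)]

end SquareMatrixFields

end Coord

/-! ### Connections, curvature and metrics -/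

namespace Coord

open scoped Matrix

section Connection

variable {m n : Type*} {Γ : Fin 4 → R4 → Matrix n n ℝ} {T : Set R4} {X Y : R4 → Matrix n n ℝ}
  {y : R4}

variable [Fintype n]

/-- The curvature `Ω_{ij} = ∂_i Γ_j - ∂_j Γ_i + [Γ_i, Γ_j]` of the connection `d + Γ` on the
trivial vector bundle. -/
def curvMat (Γ : Fin 4 → R4 → Matrix n n ℝ) (i j : Fin 4) (y : R4) : Matrix n n ℝ :=
  mderiv i (Γ j) y - mderiv j (Γ i) y + (Γ i y * Γ j y - Γ j y * Γ i y)

/-- The covariant derivative `∇_i X = ∂_i X + [Γ_i, X]` of an endomorphism field for the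
connection `d + Γ`. -/
def covDeriv (Γ : Fin 4 → R4 → Matrix n n ℝ) (i : Fin 4) (X : R4 → Matrix n n ℝ) (y : R4) :
    Matrix n n ℝ :=
  mderiv i X y + (Γ i y * X y - X y * Γ i y)

/-- `P` intertwines the connections `d + Γ` and `d + Γ'`, i.e. it is parallel as a section of the
bundle of homomorphisms. Changes of coordinates and parallel metrics are both of this form. -/
def IsParallelHom [Fintype m] (Γ : Fin 4 → R4 → Matrix n n ℝ) (Γ' : Fin 4 → R4 → Matrix m m ℝ)
    (P : R4 → Matrix m n ℝ) (T : Set R4) : Prop :=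
  ∀ z ∈ T, ∀ i, mderiv i P z = P z * Γ i z - Γ' i z * P z

theorem covDeriv_congr {i : Fin 4} (hT : IsOpen T) (hy : y ∈ T) (hXY : Set.EqOn X Y T) :
    covDeriv Γ i X y = covDeriv Γ i Y y := by
  rw [covDeriv, covDeriv, mderiv_congr hT hy hXY, hXY hy]

theorem curvMat_swap (i j : Fin 4) (y : R4) : curvMat Γ j i y = -curvMat Γ i j y := by
  simp only [curvMat]
  noncomm_ring

theorem covDeriv_mul (hT : IsOpen T) (hX : SmoothOn X T) (hY : SmoothOn Y T) (hy : y ∈ T)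
    (i : Fin 4) :
    covDeriv Γ i (fun z => X z * Y z) y = covDeriv Γ i X y * Y y + X y * covDeriv Γ i Y y := by
  simp only [covDeriv, mderiv_mul hT hX hY hy]
  noncomm_ring

theorem pderiv_trace_eq_trace_covDeriv (hT : IsOpen T) (hX : SmoothOn X T) (hy : y ∈ T)
    (i : Fin 4) : pderiv i (fun z => (X z).trace) y = (covDeriv Γ i X y).trace := by
  rw [pderiv_trace hT hX hy, covDeriv, Matrix.trace_add, Matrix.trace_sub,
    Matrix.trace_mul_comm (Γ i y), sub_self, add_zero]

variable (hT : IsOpen T) (hΓ : ∀ i, SmoothOn (Γ i) T)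
include hT hΓ

theorem smoothOn_covDeriv (hX : SmoothOn X T) (i : Fin 4) : SmoothOn (covDeriv Γ i X) T :=
  (hX.mderiv hT i).add (((hΓ i).mul hX).sub (hX.mul (hΓ i)))

theorem smoothOn_curvMat (i j : Fin 4) : SmoothOn (curvMat Γ i j) T :=
  (((hΓ j).mderiv hT i).sub ((hΓ i).mderiv hT j)).add
    (((hΓ i).mul (hΓ j)).sub ((hΓ j).mul (hΓ i)))

theorem mderiv_covDeriv (hX : SmoothOn X T) (hy : y ∈ T) (i j : Fin 4) :
    mderiv i (covDeriv Γ j X) y = mderiv i (mderiv j X) y +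
      (mderiv i (Γ j) y * X y + Γ j y * mderiv i X y
        - (mderiv i X y * Γ j y + X y * mderiv i (Γ j) y)) := by
  change mderiv i (fun z => mderiv j X z + (Γ j z * X z - X z * Γ j z)) y = _
  rw [mderiv_add hT (hX.mderiv hT j) (((hΓ j).mul hX).sub (hX.mul (hΓ j))) hy,
    mderiv_sub hT ((hΓ j).mul hX) (hX.mul (hΓ j)) hy, mderiv_mul hT (hΓ j) hX hy,
    mderiv_mul hT hX (hΓ j) hy]

/-- The Ricci identity. -/
theorem covDeriv_covDeriv_sub (hX : SmoothOn X T) (hy : y ∈ T) (i j : Fin 4) :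
    covDeriv Γ i (covDeriv Γ j X) y - covDeriv Γ j (covDeriv Γ i X) y =
      curvMat Γ i j y * X y - X y * curvMat Γ i j y := by
  have expand (i j : Fin 4) : covDeriv Γ i (covDeriv Γ j X) y = mderiv i (covDeriv Γ j X) y +
      (Γ i y * covDeriv Γ j X y - covDeriv Γ j X y * Γ i y) := rfl
  rw [expand i j, expand j i, mderiv_covDeriv hT hΓ hX hy, mderiv_covDeriv hT hΓ hX hy,
    mderiv_comm hT hX hy i j, covDeriv, covDeriv, curvMat]
  noncomm_ring

theorem mderiv_curvMat (hy : y ∈ T) (i j k : Fin 4) :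
    mderiv i (curvMat Γ j k) y = mderiv i (mderiv j (Γ k)) y - mderiv i (mderiv k (Γ j)) y
      + ((mderiv i (Γ j) y * Γ k y + Γ j y * mderiv i (Γ k) y)
        - (mderiv i (Γ k) y * Γ j y + Γ k y * mderiv i (Γ j) y)) := by
  change mderiv i (fun z => (mderiv j (Γ k) z - mderiv k (Γ j) z)
    + (Γ j z * Γ k z - Γ k z * Γ j z)) y = _
  rw [mderiv_add hT (((hΓ k).mderiv hT j).sub ((hΓ j).mderiv hT k))
      (((hΓ j).mul (hΓ k)).sub ((hΓ k).mul (hΓ j))) hy,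
    mderiv_sub hT ((hΓ k).mderiv hT j) ((hΓ j).mderiv hT k) hy,
    mderiv_sub hT ((hΓ j).mul (hΓ k)) ((hΓ k).mul (hΓ j)) hy,
    mderiv_mul hT (hΓ j) (hΓ k) hy, mderiv_mul hT (hΓ k) (hΓ j) hy]

/-- The differential Bianchi identity. -/
theorem covDeriv_curvMat_bianchi (hy : y ∈ T) (i j k : Fin 4) :
    covDeriv Γ i (curvMat Γ j k) y + covDeriv Γ j (curvMat Γ k i) y
      + covDeriv Γ k (curvMat Γ i j) y = 0 := by
  have hcomm := fun i j k => mderiv_comm hT (hΓ k) hy i j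
  simp only [covDeriv, mderiv_curvMat hT hΓ hy]
  rw [hcomm i j k, hcomm k i j, hcomm k j i]
  simp only [curvMat]
  noncomm_ring

omit hΓ in
theorem IsParallelHom.mul_covDeriv [Fintype m] {Γ' : Fin 4 → R4 → Matrix m m ℝ}
    {P : R4 → Matrix m n ℝ} {X' : R4 → Matrix m m ℝ} (h : IsParallelHom Γ Γ' P T)
    (hP : SmoothOn P T) (hX : SmoothOn X T) (hX' : SmoothOn X' T)
    (hPX : ∀ z ∈ T, P z * X z = X' z * P z) (hy : y ∈ T) (i : Fin 4) :
    P y * covDeriv Γ i X y = covDeriv Γ' i X' y * P y := by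
  have hderiv := mderiv_congr (i := i) hT hy hPX
  rw [mderiv_mul hT hP hX hy, mderiv_mul hT hX' hP hy, h y hy] at hderiv
  calc P y * covDeriv Γ i X y
      = ((P y * Γ i y - Γ' i y * P y) * X y + P y * mderiv i X y)
        + (Γ' i y * (P y * X y) - (P y * X y) * Γ i y) := by
        simp only [covDeriv, Matrix.mul_add, Matrix.mul_sub, Matrix.sub_mul, Matrix.mul_assoc]
        abel
    _ = covDeriv Γ' i X' y * P y := by
        rw [hderiv, hPX y hy]
        simp only [covDeriv, Matrix.add_mul, Matrix.mul_sub, Matrix.sub_mul, Matrix.mul_assoc]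
        abel

theorem IsParallelHom.mul_curvMat [Fintype m] {Γ' : Fin 4 → R4 → Matrix m m ℝ}
    {P : R4 → Matrix m n ℝ} (h : IsParallelHom Γ Γ' P T) (hP : SmoothOn P T)
    (hΓ' : ∀ i, SmoothOn (Γ' i) T) (hy : y ∈ T) (i j : Fin 4) :
    P y * curvMat Γ i j y = curvMat Γ' i j y * P y := by
  have second_deriv (i j : Fin 4) : mderiv i (mderiv j P) y =
      ((P y * Γ i y - Γ' i y * P y) * Γ j y + P y * mderiv i (Γ j) y)
        - (mderiv i (Γ' j) y * P y + Γ' j y * (P y * Γ i y - Γ' i y * P y)) := by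
    rw [mderiv_congr hT hy fun z hz => h z hz j,
      mderiv_sub hT (hP.mul (hΓ j)) ((hΓ' j).mul hP) hy, mderiv_mul hT hP (hΓ j) hy,
      mderiv_mul hT (hΓ' j) hP hy, h y hy i]
  have hcomm := mderiv_comm hT hP hy i j
  rw [second_deriv i j, second_deriv j i, ← sub_eq_zero] at hcomm
  rw [← sub_eq_zero, ← hcomm]
  simp only [curvMat, Matrix.mul_add, Matrix.mul_sub, Matrix.add_mul, Matrix.sub_mul,
    Matrix.mul_assoc]
  abel

end Connection

section Metric

/-- `G` is a smooth field of positive definite symmetric matrices on the open set `T`. -/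
structure IsMetricOn (G : R4 → Matrix (Fin 4) (Fin 4) ℝ) (T : Set R4) : Prop where
  isOpen : IsOpen T
  smooth : SmoothOn G T
  posDef : ∀ y ∈ T, (G y).PosDef

/-- The connection matrices `(Γ_i)^k_j = Γ^k_{ij}` of the Levi-Civita connection. -/
def conn (G : R4 → Matrix (Fin 4) (Fin 4) ℝ) (i : Fin 4) (y : R4) : Matrix (Fin 4) (Fin 4) ℝ :=
  Matrix.of fun k j => christoffel G k i j y

theorem curvMat_conn_apply (G : R4 → Matrix (Fin 4) (Fin 4) ℝ) (i j k l : Fin 4) (y : R4) :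
    curvMat (conn G) i j y l k = curvature G i j k l y := by
  simp only [curvMat, curvature, Matrix.add_apply, Matrix.sub_apply, Matrix.mul_apply,
    Finset.sum_sub_distrib]
  rfl

theorem riemann_eq (G : R4 → Matrix (Fin 4) (Fin 4) ℝ) (i j k l : Fin 4) (y : R4) :
    riemann G i j k l y = ((curvMat (conn G) i j y)ᵀ * G y) k l := by
  simp only [riemann, Matrix.mul_apply, Matrix.transpose_apply, curvMat_conn_apply]

/-- The pair symmetry of curvature-like tensors. -/
theorem pair_symm_of_cyclic {ι : Type*} {K : ι → ι → ι → ι → ℝ}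
    (hleft : ∀ i j k l, K j i k l = -K i j k l) (hright : ∀ i j k l, K i j l k = -K i j k l)
    (hcyclic : ∀ i j k l, K i j k l + K j k i l + K k i j l = 0) (i j k l : ι) :
    K i j k l = K k l i j := by
  linarith [hcyclic i j k l, hcyclic j k l i, hcyclic k l i j, hcyclic l i j k, hright i j k l,
    hright j k i l, hright i k j l, hright k l i j, hright l i j k, hright l j i k, hleft k i j l,
    hleft l j i k]

namespace IsMetricOn

variable {G : R4 → Matrix (Fin 4) (Fin 4) ℝ} {T : Set R4} {X : R4 → Matrix (Fin 4) (Fin 4) ℝ}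
  {y : R4} (hG : IsMetricOn G T)
include hG

theorem transpose_eq (hy : y ∈ T) : (G y)ᵀ = G y := by
  simpa using (hG.posDef y hy).isHermitian.eq

theorem apply_comm (hy : y ∈ T) (i j : Fin 4) : G y i j = G y j i :=
  congr_fun₂ (hG.transpose_eq hy) j i

theorem det_ne_zero (hy : y ∈ T) : (G y).det ≠ 0 := (hG.posDef y hy).det_pos.ne'

theorem isUnit_det (hy : y ∈ T) : IsUnit (G y).det := (hG.det_ne_zero hy).isUnit

theorem smooth_inv : SmoothOn (fun z => (G z)⁻¹) T := hG.smooth.inv fun _ => hG.det_ne_zero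

theorem inv_transpose (hy : y ∈ T) : ((G y)⁻¹)ᵀ = (G y)⁻¹ := by
  rw [Matrix.transpose_nonsing_inv, hG.transpose_eq hy]

theorem mderiv_apply_comm (hy : y ∈ T) (l i j : Fin 4) : mderiv l G y i j = mderiv l G y j i :=
  pderiv_congr hG.isOpen hy fun _ hz => hG.apply_comm hz i j

theorem conn_symm (hy : y ∈ T) (i j k : Fin 4) : conn G i y k j = conn G j y k i := by
  have hcomm := hG.mderiv_apply_comm hy
  simp only [mderiv_apply] at hcomm
  simp only [conn, christoffel, Matrix.of_apply, hcomm _ i j]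
  congr! 3
  ring

theorem mul_conn_apply (hy : y ∈ T) (i j l : Fin 4) :
    (G y * conn G i y) l j =
      (1 / 2) * (mderiv i G y j l + mderiv j G y i l - mderiv l G y i j) := by
  have conn_eq : conn G i y = (G y)⁻¹ * Matrix.of fun l j =>
      (1 / 2) * (mderiv i G y j l + mderiv j G y i l - mderiv l G y i j) := by
    ext k j
    simp only [conn, christoffel, Matrix.of_apply, Matrix.mul_apply, Finset.mul_sum, mderiv_apply,
      mul_left_comm]
  rw [conn_eq, Matrix.mul_nonsing_inv_cancel_left _ _ (hG.isUnit_det hy), Matrix.of_apply]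

theorem transpose_mul_eq (hy : y ∈ T) (X : Matrix (Fin 4) (Fin 4) ℝ) :
    Xᵀ * G y = (G y * X)ᵀ := by
  rw [Matrix.transpose_mul, hG.transpose_eq hy]

theorem mderiv_eq_conn (hy : y ∈ T) (i : Fin 4) :
    mderiv i G y = (conn G i y)ᵀ * G y + G y * conn G i y := by
  have hcomm := hG.mderiv_apply_comm hy
  ext a b
  rw [hG.transpose_mul_eq hy, Matrix.add_apply, Matrix.transpose_apply, hG.mul_conn_apply hy,
    hG.mul_conn_apply hy, hcomm i b a, hcomm a i b, hcomm b i a]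
  ring

theorem conn_unique (hy : y ∈ T) {Γ : Fin 4 → Matrix (Fin 4) (Fin 4) ℝ}
    (hsymm : ∀ i j k, Γ i k j = Γ j k i)
    (hmetric : ∀ i, mderiv i G y = (Γ i)ᵀ * G y + G y * Γ i) (i : Fin 4) : Γ i = conn G i y := by
  have lower_symm (i j l : Fin 4) : (G y * Γ i) l j = (G y * Γ j) l i := by
    simp only [Matrix.mul_apply, hsymm i j]
  have koszul (i j l : Fin 4) : mderiv i G y j l = (G y * Γ i) l j + (G y * Γ i) j l := by
    rw [hmetric, hG.transpose_mul_eq hy]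
    rfl
  have hmul : G y * Γ i = G y * conn G i y := by
    ext l j
    rw [hG.mul_conn_apply hy, koszul, koszul, koszul, lower_symm i j l, lower_symm l i j,
      lower_symm j l i]
    ring
  rw [← Matrix.nonsing_inv_mul_cancel_left _ (Γ i) (hG.isUnit_det hy), hmul,
    Matrix.nonsing_inv_mul_cancel_left _ _ (hG.isUnit_det hy)]

theorem smooth_conn (i : Fin 4) : SmoothOn (conn G i) T := by
  intro k j
  have smooth_pderiv (i a b : Fin 4) : ContDiffOn ℝ ∞ (pderiv i fun z => G z a b) T :=
    contDiffOn_pderiv hG.isOpen (hG.smooth a b) i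
  exact contDiffOn_const.mul (ContDiffOn.sum fun l _ => (hG.smooth_inv k l).mul
    (((smooth_pderiv _ _ _).add (smooth_pderiv _ _ _)).sub (smooth_pderiv _ _ _)))

/-- The metric is parallel, viewed as a homomorphism from the tangent to the cotangent bundle. -/
theorem isParallelHom : IsParallelHom (conn G) (fun i z => -(conn G i z)ᵀ) G T := by
  intro z hz i
  rw [hG.mderiv_eq_conn hz]
  noncomm_ring

theorem isSkewAdjoint_covDeriv (hX : SmoothOn X T) (hskew : ∀ z ∈ T, (G z).IsSkewAdjoint (X z))
    (hy : y ∈ T) (i : Fin 4) : (G y).IsSkewAdjoint (covDeriv (conn G) i X y) := by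
  have hdual := hG.isParallelHom.mul_covDeriv hG.isOpen hG.smooth hX
    (X' := fun z => -(X z)ᵀ) hX.transpose.neg
    (fun z hz => by rw [Matrix.neg_mul, hskew z hz, Matrix.mul_neg, neg_neg]) hy i
  have covDeriv_dual : covDeriv (fun i z => -(conn G i z)ᵀ) i (fun z => -(X z)ᵀ) y =
      -(covDeriv (conn G) i X y)ᵀ := by
    rw [covDeriv, covDeriv, mderiv_neg, mderiv_transpose]
    simp only [Matrix.transpose_add, Matrix.transpose_sub, Matrix.transpose_mul]
    noncomm_ring
  rw [covDeriv_dual, Matrix.neg_mul] at hdual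
  change _ * _ = _ * _
  rw [Matrix.mul_neg, hdual, neg_neg]

theorem isSkewAdjoint_curvMat (hy : y ∈ T) (i j : Fin 4) :
    (G y).IsSkewAdjoint (curvMat (conn G) i j y) := by
  have hdual := hG.isParallelHom.mul_curvMat hG.isOpen hG.smooth_conn hG.smooth
    (fun i => (hG.smooth_conn i).transpose.neg) hy i j
  have curvMat_dual : curvMat (fun i z => -(conn G i z)ᵀ) i j y =
      -(curvMat (conn G) i j y)ᵀ := by
    simp only [curvMat, mderiv_neg, mderiv_transpose, Matrix.transpose_add, Matrix.transpose_sub,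
      Matrix.transpose_mul]
    noncomm_ring
  rw [curvMat_dual, Matrix.neg_mul] at hdual
  change _ * _ = _ * _
  rw [Matrix.mul_neg, hdual, neg_neg]

theorem curvMat_bianchi (hy : y ∈ T) (i j k l : Fin 4) :
    curvMat (conn G) i j y l k + curvMat (conn G) j k y l i + curvMat (conn G) k i y l j = 0 := by
  have mderiv_symm (m i j k : Fin 4) : mderiv m (conn G i) y k j = mderiv m (conn G j) y k i :=
    pderiv_congr hG.isOpen hy fun z hz => hG.conn_symm hz i j k
  have mul_symm (i j k : Fin 4) :
      (conn G i y * conn G j y) l k = (conn G i y * conn G k y) l j := by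
    simp only [Matrix.mul_apply, hG.conn_symm hy j k]
  simp only [curvMat, Matrix.add_apply, Matrix.sub_apply]
  rw [mderiv_symm i j k, mderiv_symm j k i, mderiv_symm k i j, mul_symm i j k, mul_symm j k i,
    mul_symm k i j]
  ring

theorem mul_curvMat_pair_symm (hy : y ∈ T) (i j k l : Fin 4) :
    (G y * curvMat (conn G) i j y) l k = (G y * curvMat (conn G) k l y) j i := by
  refine pair_symm_of_cyclic (K := fun i j k l => (G y * curvMat (conn G) i j y) l k)
    (fun i j k l => ?_) (fun i j k l => ?_) (fun i j k l => ?_) i j k l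
  · rw [curvMat_swap i j, Matrix.mul_neg, Matrix.neg_apply]
  · have hskew : _ * _ = _ * _ := hG.isSkewAdjoint_curvMat hy i j
    rw [hG.transpose_mul_eq hy, Matrix.mul_neg] at hskew
    exact congr_fun₂ hskew l k
  · simp only [Matrix.mul_apply, ← Finset.sum_add_distrib, ← mul_add, hG.curvMat_bianchi hy,
      mul_zero, Finset.sum_const_zero]

end IsMetricOn

end Metric

end Coord

/-! ### Endomorphisms of a Hermitian 4-space -/

namespace Coord

open scoped Matrix

section UnitaryFrame

variable {V : Type*} [AddCommGroup V] [Module ℝ V] {b : LinearMap.BilinForm ℝ V} {J : V →ₗ[ℝ] V}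

theorem exists_smul_unit (hpos : ∀ u, u ≠ 0 → 0 < b u u) {u : V} (hu : u ≠ 0) :
    ∃ c : ℝ, b (c • u) (c • u) = 1 := by
  refine ⟨(Real.sqrt (b u u))⁻¹, ?_⟩
  rw [map_smul, map_smul, LinearMap.smul_apply, smul_eq_mul, smul_eq_mul, ← mul_assoc, ← mul_inv,
    Real.mul_self_sqrt (hpos u hu).le, inv_mul_cancel₀ (hpos u hu).ne']

theorem exists_unit_orthogonal [FiniteDimensional ℝ V] (hpos : ∀ u, u ≠ 0 → 0 < b u u) {k : ℕ}
    (w : Fin k → V) (hk : k < Module.finrank ℝ V) : ∃ v, b v v = 1 ∧ ∀ i, b (w i) v = 0 := by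
  obtain ⟨v, hv, hv0⟩ := (Submodule.ne_bot_iff _).1 <|
    LinearMap.ker_ne_bot_of_finrank_lt (f := LinearMap.pi fun i => b (w i)) (by simpa using hk)
  obtain ⟨c, hc⟩ := exists_smul_unit hpos hv0
  refine ⟨c • v, hc, fun i => ?_⟩
  have orthogonal : b (w i) v = 0 := congr_fun (LinearMap.mem_ker.1 hv) i
  rw [map_smul, orthogonal, smul_zero]

theorem apply_map_right (hJ : ∀ u, J (J u) = -u) (hb : ∀ u v, b (J u) (J v) = b u v) (u v : V) :
    b u (J v) = -b (J u) v := by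
  rw [← hb u, hJ, map_neg]

theorem apply_map_self (hsymm : ∀ u v, b u v = b v u) (hJ : ∀ u, J (J u) = -u)
    (hb : ∀ u v, b (J u) (J v) = b u v) (u : V) : b u (J u) = 0 := by
  linarith [apply_map_right hJ hb u u, hsymm u (J u)]

theorem exists_unitary_frame [FiniteDimensional ℝ V] (hV : Module.finrank ℝ V = 4)
    (hsymm : ∀ u v, b u v = b v u) (hpos : ∀ u, u ≠ 0 → 0 < b u u)
    (hJ : ∀ u, J (J u) = -u) (hb : ∀ u v, b (J u) (J v) = b u v) :
    ∃ u v, ∀ i j, b (![u, J u, v, J v] i) (![u, J u, v, J v] j) =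
      (1 : Matrix (Fin 4) (Fin 4) ℝ) i j := by
  obtain ⟨u, hu, -⟩ := exists_unit_orthogonal hpos (k := 0) ![] (by omega)
  obtain ⟨v, hv, huv⟩ := exists_unit_orthogonal hpos ![u, J u] (by omega)
  have b_u_v : b u v = 0 := huv 0
  have b_Ju_v : b (J u) v = 0 := huv 1
  have b_u_Jv : b u (J v) = 0 := by rw [apply_map_right hJ hb, b_Ju_v, neg_zero]
  have b_self_J := apply_map_self hsymm hJ hb
  refine ⟨u, v, fun i j => ?_⟩
  fin_cases i <;> fin_cases j <;>
    simp [hb, hu, hv, b_u_v, b_Ju_v, b_u_Jv, b_self_J, hsymm (J u) u, hsymm v, hsymm (J v)]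

end UnitaryFrame

section Conjugation

variable {n R : Type*} [Fintype n] [DecidableEq n] [CommRing R] {P Q : Matrix n n R}

theorem conj_mul_conj (hPQ : P * Q = 1) (X Y : Matrix n n R) :
    (Q * X * P) * (Q * Y * P) = Q * (X * Y) * P := by
  calc (Q * X * P) * (Q * Y * P) = Q * X * (P * Q) * Y * P := by noncomm_ring
    _ = Q * (X * Y) * P := by rw [hPQ]; noncomm_ring

theorem trace_conj (hPQ : P * Q = 1) (X : Matrix n n R) : (Q * X * P).trace = X.trace := by
  rw [Matrix.trace_mul_comm, ← Matrix.mul_assoc, hPQ, Matrix.one_mul]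

theorem conj_injective (hPQ : P * Q = 1) : Function.Injective fun X => Q * X * P := by
  have conj_symm (X : Matrix n n R) : P * (Q * X * P) * Q = X := by
    calc P * (Q * X * P) * Q = (P * Q) * X * (P * Q) := by noncomm_ring
      _ = X := by rw [hPQ, Matrix.one_mul, Matrix.mul_one]
  exact Function.LeftInverse.injective (g := fun X => P * X * Q) conj_symm

end Conjugation

section StandardComplexStructure

/-- The standard complex structure on `ℝ⁴`. -/
def stdJ : Matrix (Fin 4) (Fin 4) ℝ := !![0, -1, 0, 0; 1, 0, 0, 0; 0, 0, 0, -1; 0, 0, 1, 0]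

variable {S B C : Matrix (Fin 4) (Fin 4) ℝ}

theorem eq_of_transpose_eq_neg_of_anticomm_stdJ (hB : Bᵀ = -B) (hBJ : B * stdJ = -(stdJ * B)) :
    B = !![0, 0, B 0 2, B 0 3; 0, 0, B 0 3, -B 0 2; -B 0 2, -B 0 3, 0, 0;
      -B 0 3, B 0 2, 0, 0] := by
  have skew (i j : Fin 4) : B j i = -B i j := congr_fun₂ hB i j
  have anticomm (i j : Fin 4) : (B * stdJ) i j = -(stdJ * B) i j := congr_fun₂ hBJ i j
  have h00 := anticomm 0 0
  have h22 := anticomm 2 2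
  have h02 := anticomm 0 2
  have h03 := anticomm 0 3
  simp only [stdJ, Fin.isValue, Matrix.mul_apply, Matrix.of_apply, Matrix.cons_val',
    Matrix.cons_val_zero, Matrix.cons_val_fin_one, Fin.sum_univ_four, mul_zero, Matrix.cons_val_one,
    mul_one, zero_add, Matrix.cons_val, add_zero, zero_mul, neg_mul, one_mul, neg_neg,
    mul_neg] at h00 h22 h02 h03
  ext i j
  fin_cases i <;> fin_cases j <;> simp <;>
    linarith [skew 0 0, skew 1 1, skew 2 2, skew 3 3, skew 0 1, skew 0 2, skew 0 3, skew 1 2,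
      skew 1 3, skew 2 3]

theorem eq_of_transpose_eq_neg_of_comm_stdJ (hS : Sᵀ = -S) (hSJ : S * stdJ = stdJ * S) :
    S = !![0, S 0 1, S 0 2, S 0 3; -S 0 1, 0, -S 0 3, S 0 2; -S 0 2, S 0 3, 0, S 2 3;
      -S 0 3, -S 0 2, -S 2 3, 0] := by
  have skew (i j : Fin 4) : S j i = -S i j := congr_fun₂ hS i j
  have comm (i j : Fin 4) : (S * stdJ) i j = (stdJ * S) i j := congr_fun₂ hSJ i j
  have h02 := comm 0 2
  have h03 := comm 0 3
  simp only [stdJ, Fin.isValue, Matrix.mul_apply, Matrix.of_apply, Matrix.cons_val',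
    Matrix.cons_val, Matrix.cons_val_fin_one, Fin.sum_univ_four, Matrix.cons_val_zero, mul_zero,
    Matrix.cons_val_one, add_zero, mul_one, zero_add, zero_mul, neg_mul, one_mul, mul_neg,
    neg_inj] at h02 h03
  ext i j
  fin_cases i <;> fin_cases j <;> simp <;>
    linarith [skew 0 0, skew 1 1, skew 2 2, skew 3 3, skew 0 1, skew 0 2, skew 0 3, skew 1 2,
      skew 1 3, skew 2 3]

theorem stdJ_commutator_comm_anticomm (hS : Sᵀ = -S) (hSJ : S * stdJ = stdJ * S)
    (hB : Bᵀ = -B) (hBJ : B * stdJ = -(stdJ * B)) :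
    S * B - B * S = (-(1 / 2) * (stdJ * S).trace) • (stdJ * B) := by
  rw [eq_of_transpose_eq_neg_of_anticomm_stdJ hB hBJ, eq_of_transpose_eq_neg_of_comm_stdJ hS hSJ]
  ext i j
  fin_cases i <;> fin_cases j <;>
    simp [Fin.sum_univ_four, stdJ, Matrix.trace] <;> ring

theorem stdJ_commutator_anticomm (hB : Bᵀ = -B) (hBJ : B * stdJ = -(stdJ * B))
    (hC : Cᵀ = -C) (hCJ : C * stdJ = -(stdJ * C)) :
    B * C - C * B = (-(1 / 2) * (stdJ * (B * C)).trace) • stdJ := by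
  rw [eq_of_transpose_eq_neg_of_anticomm_stdJ hB hBJ,
    eq_of_transpose_eq_neg_of_anticomm_stdJ hC hCJ]
  ext i j
  fin_cases i <;> fin_cases j <;>
    simp [Fin.sum_univ_four, stdJ, Matrix.trace] <;> ring

end StandardComplexStructure

section HermitianLinearAlgebra

variable {g J S B C : Matrix (Fin 4) (Fin 4) ℝ} (hg : g.PosDef) (hJ : J * J = -1)
  (hJg : Jᵀ * g * J = g)
include hg hJ hJg

theorem exists_orthonormal_mul_stdJ :
    ∃ P : Matrix (Fin 4) (Fin 4) ℝ, Pᵀ * g * P = 1 ∧ J * P = P * stdJ := by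
  have apply_eq (u v : Fin 4 → ℝ) : Matrix.toBilin' g u v = u ⬝ᵥ g *ᵥ v :=
    Matrix.toBilin'_apply' g u v
  have gT : gᵀ = g := by simpa using hg.isHermitian.eq
  have mulVec_mulVec_J (u : Fin 4 → ℝ) : J *ᵥ (J *ᵥ u) = -u := by
    rw [Matrix.mulVec_mulVec, hJ, Matrix.neg_mulVec, Matrix.one_mulVec]
  obtain ⟨u, v, huv⟩ := exists_unitary_frame (b := Matrix.toBilin' g) (J := J.mulVecLin)
    (by simp)
    (fun u v => by
      rw [apply_eq, apply_eq, dotProduct_comm, ← Matrix.vecMul_transpose, gT,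
        ← Matrix.dotProduct_mulVec])
    (fun u hu => by simpa [apply_eq] using hg.dotProduct_mulVec_pos hu)
    mulVec_mulVec_J
    (fun u v => by
      rw [apply_eq, apply_eq, Matrix.mulVecLin_apply, Matrix.mulVecLin_apply,
        ← Matrix.vecMul_transpose, ← Matrix.dotProduct_mulVec, Matrix.mulVec_mulVec,
        Matrix.mulVec_mulVec, hJg])
  simp only [Matrix.mulVecLin_apply, apply_eq] at huv
  refine ⟨(Matrix.of ![u, J *ᵥ u, v, J *ᵥ v])ᵀ, ?_, ?_⟩
  · ext i j
    rw [← huv i j, Matrix.mul_assoc]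
    rfl
  · ext i j
    change (J *ᵥ ![u, J *ᵥ u, v, J *ᵥ v] j) i = _
    simp only [Matrix.mul_apply, Fin.sum_univ_four, stdJ, Matrix.transpose_apply]
    fin_cases j <;> simp [mulVec_mulVec_J]

/-- Conjugation by a unitary frame reduces identities between endomorphisms to the standard
complex structure. -/
theorem exists_conj_eq_stdJ :
    ∃ P Q : Matrix (Fin 4) (Fin 4) ℝ, P * Q = 1 ∧ Q * J * P = stdJ ∧
      ∀ X, g.IsSkewAdjoint X → (Q * X * P)ᵀ = -(Q * X * P) := by
  obtain ⟨P, hP, hJP⟩ := exists_orthonormal_mul_stdJ hg hJ hJg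
  refine ⟨P, Pᵀ * g, mul_eq_one_comm.1 hP, ?_, fun X (hX : Xᵀ * g = g * -X) => ?_⟩
  · rw [Matrix.mul_assoc, hJP, ← Matrix.mul_assoc, hP, Matrix.one_mul]
  · have gT : gᵀ = g := by simpa using hg.isHermitian.eq
    calc (Pᵀ * g * X * P)ᵀ = Pᵀ * (Xᵀ * g) * P := by
          simp only [Matrix.transpose_mul, Matrix.transpose_transpose, gT, Matrix.mul_assoc]
      _ = -(Pᵀ * g * X * P) := by rw [hX]; noncomm_ring

theorem commutator_comm_anticomm (hS : g.IsSkewAdjoint S) (hSJ : S * J = J * S)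
    (hB : g.IsSkewAdjoint B) (hBJ : B * J = -(J * B)) :
    S * B - B * S = (-(1 / 2) * (J * S).trace) • (J * B) := by
  obtain ⟨P, Q, hPQ, hQJP, skew⟩ := exists_conj_eq_stdJ hg hJ hJg
  have conj := stdJ_commutator_comm_anticomm (skew S hS)
    (by rw [← hQJP, conj_mul_conj hPQ, conj_mul_conj hPQ, hSJ]) (skew B hB)
    (by rw [← hQJP, conj_mul_conj hPQ, conj_mul_conj hPQ, hBJ, Matrix.mul_neg, Matrix.neg_mul])
  refine conj_injective hPQ ?_
  simp only [← hQJP, conj_mul_conj hPQ, trace_conj hPQ] at conj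
  simp only [Matrix.mul_smul, Matrix.smul_mul, ← conj, Matrix.mul_sub, Matrix.sub_mul]

theorem commutator_anticomm (hB : g.IsSkewAdjoint B) (hBJ : B * J = -(J * B))
    (hC : g.IsSkewAdjoint C) (hCJ : C * J = -(J * C)) :
    B * C - C * B = (-(1 / 2) * (J * (B * C)).trace) • J := by
  obtain ⟨P, Q, hPQ, hQJP, skew⟩ := exists_conj_eq_stdJ hg hJ hJg
  have anticomm {X} (hX : X * J = -(J * X)) : (Q * X * P) * stdJ = -(stdJ * (Q * X * P)) := by
    rw [← hQJP, conj_mul_conj hPQ, conj_mul_conj hPQ, hX, Matrix.mul_neg, Matrix.neg_mul]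
  have conj := stdJ_commutator_anticomm (skew B hB) (anticomm hBJ) (skew C hC) (anticomm hCJ)
  refine conj_injective hPQ ?_
  simp only [← hQJP, conj_mul_conj hPQ, trace_conj hPQ] at conj
  simp only [Matrix.mul_smul, Matrix.smul_mul, ← conj, Matrix.mul_sub, Matrix.sub_mul]

end HermitianLinearAlgebra

end Coord

/-! ### The forms `β` and `ρ` of an almost Hermitian structure -/

namespace Coord

open scoped Matrix

section Algebra

variable {n R : Type*} [Fintype n] [CommRing R] {g J X : Matrix n n R}

theorem isSkewAdjoint_mul_of_anticomm (hJ : g.IsSkewAdjoint J) (hX : g.IsSkewAdjoint X)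
    (hXJ : X * J = -(J * X)) : g.IsSkewAdjoint (J * X) := by
  change _ * _ = _ * _ at hJ hX ⊢
  rw [Matrix.transpose_mul, Matrix.mul_assoc, hJ, ← Matrix.mul_assoc, hX, Matrix.mul_assoc,
    neg_mul_neg, hXJ]

theorem transpose_mul_inv_of_isSkewAdjoint [DecidableEq n] (hgT : gᵀ = g) (hg : IsUnit g.det)
    (hX : g.IsSkewAdjoint X) : (X * g⁻¹)ᵀ = -(X * g⁻¹) := by
  change _ * _ = _ * _ at hX
  rw [Matrix.transpose_mul, Matrix.transpose_nonsing_inv, hgT,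
    ← Matrix.mul_nonsing_inv_cancel_right g Xᵀ hg, hX, ← Matrix.mul_assoc,
    Matrix.nonsing_inv_mul_cancel_left _ _ hg, Matrix.neg_mul]

theorem trace_eq_zero_of_anticomm [DecidableEq n] [NeZero (2 : R)] [NoZeroDivisors R]
    (hJ : J * J = -1) (hXJ : X * J = -(J * X)) : X.trace = 0 := by
  have trace_eq_neg : X.trace = -X.trace := by
    calc X.trace = -(J * J * X).trace := by rw [hJ, neg_mul, one_mul, Matrix.trace_neg, neg_neg]
      _ = (J * (X * J)).trace := by rw [hXJ, mul_neg, Matrix.trace_neg, mul_assoc]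
      _ = (X * (J * J)).trace := by rw [Matrix.trace_mul_comm, mul_assoc]
      _ = -X.trace := by rw [hJ, mul_neg, mul_one, Matrix.trace_neg]
  have two_mul_trace : 2 * X.trace = 0 := by linear_combination trace_eq_neg
  exact (mul_eq_zero.1 two_mul_trace).resolve_left two_ne_zero

theorem trace_mul_transpose_eq_sum (X Y : Matrix n n R) :
    (X * Yᵀ).trace = ∑ i, ∑ j, X i j * Y i j := rfl

theorem mul_mul_apply_eq_sum (X Y Z : Matrix n n R) (k l : n) :
    (X * Y * Z) k l = ∑ i, ∑ j, X k i * Y i j * Z j l := by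
  simp only [Matrix.mul_apply, Finset.sum_mul]
  exact Finset.sum_comm

/-- If `ρ ∧ β(·, l) = 0` for all `l`, then `ρ` and `β` are proportional, the factor being detected
by any bivector `b`. -/
theorem trace_smul_eq_of_wedge_eq_zero [NeZero (2 : R)] [NoZeroDivisors R] {ρ β b : Matrix n n R}
    (hρ : ρᵀ = -ρ) (hβ : βᵀ = -β) (hb : bᵀ = -b)
    (hwedge : ∀ i j k l, ρ i j * β k l + ρ j k * β i l + ρ k i * β j l = 0) :
    (ρ * bᵀ).trace • β = (β * bᵀ).trace • ρ := by
  have ρ_swap (i j : n) : ρ j i = -ρ i j := congr_fun₂ hρ i j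
  have β_swap (i j : n) : β j i = -β i j := congr_fun₂ hβ i j
  have b_swap (i j : n) : b j i = -b i j := congr_fun₂ hb i j
  have contract_left (k l : n) : (ρ * bᵀ).trace * β k l = -2 * (ρ * b * β) k l := by
    have hsum : ∑ i, ∑ j, (ρ i j * β k l + ρ j k * β i l + ρ k i * β j l) * b i j = 0 := by
      simp only [hwedge, zero_mul, Finset.sum_const_zero]
    have second_term : ∑ i, ∑ j, ρ j k * β i l * b i j = (ρ * b * β) k l := by
      rw [Finset.sum_comm, mul_mul_apply_eq_sum]
      refine Finset.sum_congr rfl fun j _ => Finset.sum_congr rfl fun i _ => ?_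
      rw [ρ_swap k j, b_swap j i]
      ring
    have third_term : ∑ i, ∑ j, ρ k i * β j l * b i j = (ρ * b * β) k l := by
      simp only [mul_mul_apply_eq_sum, mul_right_comm _ (β _ l)]
    simp only [add_mul, Finset.sum_add_distrib, second_term, third_term,
      mul_right_comm _ (β k l), ← Finset.sum_mul, ← trace_mul_transpose_eq_sum] at hsum
    linear_combination hsum
  have contract_right (k l : n) :
      (β * bᵀ).trace * ρ k l = (ρ * b * β) l k - (ρ * b * β) k l := by
    have hsum : ∑ i, ∑ j, (ρ k l * β i j + ρ l i * β k j + ρ i k * β l j) * b i j = 0 := by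
      simp only [hwedge, zero_mul, Finset.sum_const_zero]
    simp only [ρ_swap k, β_swap _ k, β_swap _ l, add_mul, Finset.sum_add_distrib, mul_neg,
      neg_mul, Finset.sum_neg_distrib, mul_right_comm _ (β _ k),
      mul_right_comm _ (β _ l), ← mul_mul_apply_eq_sum, mul_assoc (ρ k l), ← Finset.mul_sum,
      ← trace_mul_transpose_eq_sum] at hsum
    linear_combination hsum
  ext k l
  refine mul_left_cancel₀ (two_ne_zero (α := R)) ?_
  simp only [Matrix.smul_apply, smul_eq_mul]
  linear_combination contract_left k l - 2 * contract_right k l - contract_left l k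
    + (ρ * bᵀ).trace * β_swap k l

end Algebra

/-- `G` and `A` are the components on `T` of a metric and of an orthogonal almost complex
structure. -/
structure IsHermitianOn (G A : R4 → Matrix (Fin 4) (Fin 4) ℝ) (T : Set R4) : Prop
    extends IsMetricOn G T where
  smooth_J : SmoothOn A T
  sq : ∀ y ∈ T, A y * A y = -1
  orthogonal : ∀ y ∈ T, (A y)ᵀ * G y * A y = G y

/-- The covariant derivative `∇_i J` of the almost complex structure. -/
def nablaJ (G A : R4 → Matrix (Fin 4) (Fin 4) ℝ) (i : Fin 4) : R4 → Matrix (Fin 4) (Fin 4) ℝ :=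
  covDeriv (conn G) i A

/-- The endomorphism `J ∇_i J`; the Lee form is the contraction of the 1-form `J ∇J`. -/
def jNablaJ (G A : R4 → Matrix (Fin 4) (Fin 4) ℝ) (i : Fin 4) (y : R4) :
    Matrix (Fin 4) (Fin 4) ℝ :=
  A y * nablaJ G A i y

/-- The 2-form `β_{ij} = tr (J ∇_i J ∇_j J)`. -/
def betaForm (G A : R4 → Matrix (Fin 4) (Fin 4) ℝ) (y : R4) : Matrix (Fin 4) (Fin 4) ℝ :=
  Matrix.of fun i j => (A y * (nablaJ G A i y * nablaJ G A j y)).trace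

/-- The 2-form `ρ_{ij} = tr (J Ω_{ij})`, where `Ω` is the curvature of the metric. -/
def rhoForm (G A : R4 → Matrix (Fin 4) (Fin 4) ℝ) (y : R4) : Matrix (Fin 4) (Fin 4) ℝ :=
  Matrix.of fun i j => (A y * curvMat (conn G) i j y).trace

/-- The bivector `J g⁻¹` dual to the fundamental form. -/
def bivec (G A : R4 → Matrix (Fin 4) (Fin 4) ℝ) (y : R4) : Matrix (Fin 4) (Fin 4) ℝ :=
  A y * (G y)⁻¹

/-- The contraction `∑ β_{ij} b^{ij}` of a 2-form `β` with the bivector `b = J g⁻¹`. -/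
def contr (G A β : R4 → Matrix (Fin 4) (Fin 4) ℝ) (y : R4) : ℝ :=
  (β y * (bivec G A y)ᵀ).trace

/-- The vector field dual to the Lee form. -/
def leeVec (G A : R4 → Matrix (Fin 4) (Fin 4) ℝ) (y : R4) : Fin 4 → ℝ :=
  (G y)⁻¹ *ᵥ fun l => leeForm G A l y

variable {G A β : R4 → Matrix (Fin 4) (Fin 4) ℝ} {T : Set R4} {y : R4}

theorem rhoForm_transpose (G A : R4 → Matrix (Fin 4) (Fin 4) ℝ) (y : R4) :
    (rhoForm G A y)ᵀ = -rhoForm G A y := by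
  ext i j
  simp only [rhoForm, Matrix.transpose_apply, Matrix.neg_apply, Matrix.of_apply, curvMat_swap i j,
    Matrix.mul_neg, Matrix.trace_neg]

namespace IsHermitianOn

variable (hH : IsHermitianOn G A T)
include hH

theorem mono {T' : Set R4} (hT' : IsOpen T') (hsub : T' ⊆ T) : IsHermitianOn G A T' where
  isOpen := hT'
  smooth a b := (hH.smooth a b).mono hsub
  posDef y hy := hH.posDef y (hsub hy)
  smooth_J a b := (hH.smooth_J a b).mono hsub
  sq y hy := hH.sq y (hsub hy)
  orthogonal y hy := hH.orthogonal y (hsub hy)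

theorem isSkewAdjoint_J (hy : y ∈ T) : (G y).IsSkewAdjoint (A y) := by
  change _ * _ = _ * _
  nth_rw 2 [← hH.orthogonal y hy]
  rw [Matrix.mul_neg, Matrix.mul_assoc, hH.sq y hy, Matrix.mul_neg, neg_neg, Matrix.mul_one]

theorem smooth_nablaJ (i : Fin 4) : SmoothOn (nablaJ G A i) T :=
  smoothOn_covDeriv hH.isOpen hH.smooth_conn hH.smooth_J i

theorem smooth_jNablaJ (i : Fin 4) : SmoothOn (jNablaJ G A i) T :=
  hH.smooth_J.mul (hH.smooth_nablaJ i)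

theorem nablaJ_anticomm (hy : y ∈ T) (i : Fin 4) :
    nablaJ G A i y * A y = -(A y * nablaJ G A i y) := by
  have leibniz := covDeriv_mul (Γ := conn G) hH.isOpen hH.smooth_J hH.smooth_J hy i
  have covDeriv_neg_one : covDeriv (conn G) i (fun _ => -1) y = 0 := by
    simp [covDeriv, mderiv_const]
  rw [covDeriv_congr hH.isOpen hy hH.sq, covDeriv_neg_one] at leibniz
  exact eq_neg_of_add_eq_zero_left leibniz.symm

theorem isSkewAdjoint_nablaJ (hy : y ∈ T) (i : Fin 4) : (G y).IsSkewAdjoint (nablaJ G A i y) :=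
  hH.isSkewAdjoint_covDeriv hH.smooth_J (fun _ hz => hH.isSkewAdjoint_J hz) hy i

theorem isSkewAdjoint_jNablaJ (hy : y ∈ T) (i : Fin 4) : (G y).IsSkewAdjoint (jNablaJ G A i y) :=
  isSkewAdjoint_mul_of_anticomm (hH.isSkewAdjoint_J hy) (hH.isSkewAdjoint_nablaJ hy i)
    (hH.nablaJ_anticomm hy i)

theorem bivec_transpose (hy : y ∈ T) : (bivec G A y)ᵀ = -bivec G A y :=
  transpose_mul_inv_of_isSkewAdjoint (hH.transpose_eq hy) (hH.isUnit_det hy)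
    (hH.isSkewAdjoint_J hy)

theorem trace_mul_nablaJ_mul (hy : y ∈ T) (X : Matrix (Fin 4) (Fin 4) ℝ) (j : Fin 4) :
    (A y * (nablaJ G A j y * X)).trace = -(A y * (X * nablaJ G A j y)).trace := by
  rw [← Matrix.mul_assoc, eq_neg_of_add_eq_zero_right (eq_neg_iff_add_eq_zero.1
    (hH.nablaJ_anticomm hy j)), Matrix.neg_mul, Matrix.trace_neg, Matrix.mul_assoc,
    Matrix.trace_mul_comm, Matrix.mul_assoc]

theorem betaForm_transpose (hy : y ∈ T) : (betaForm G A y)ᵀ = -betaForm G A y := by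
  ext i j
  exact hH.trace_mul_nablaJ_mul hy _ j

theorem nablaTwo_fundamentalForm (hy : y ∈ T) (i j k : Fin 4) :
    nablaTwo G (fundamentalForm G A) i j k y = ((nablaJ G A i y)ᵀ * G y) j k := by
  have nablaTwo_eq : nablaTwo G (fundamentalForm G A) i j k y =
      (mderiv i (fun z => (A z)ᵀ * G z) y - (conn G i y)ᵀ * ((A y)ᵀ * G y)
        - ((A y)ᵀ * G y) * conn G i y) j k := by
    rw [Matrix.sub_apply, Matrix.sub_apply, Matrix.mul_apply (M := (conn G i y)ᵀ),
      Matrix.mul_apply (N := conn G i y)]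
    simp only [mul_comm _ (conn G i y _ k)]
    rfl
  rw [nablaTwo_eq, mderiv_mul hH.isOpen hH.smooth_J.transpose hH.smooth hy, mderiv_transpose,
    hH.mderiv_eq_conn hy]
  refine congrFun (congrFun ?_ j) k
  simp only [nablaJ, covDeriv, Matrix.transpose_add, Matrix.transpose_sub, Matrix.transpose_mul]
  noncomm_ring

theorem codiffTwo_fundamentalForm (hy : y ∈ T) (k : Fin 4) :
    codiffTwo G (fundamentalForm G A) k y = ∑ i, nablaJ G A i y i k := by
  have codiff_eq (i : Fin 4) :
      ∑ j, (G y)⁻¹ i j * ((nablaJ G A i y)ᵀ * G y) j k = -nablaJ G A i y i k := by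
    have hskew : _ * _ = _ * _ := hH.isSkewAdjoint_nablaJ hy i
    rw [← Matrix.mul_apply, hskew, Matrix.nonsing_inv_mul_cancel_left _ _ (hH.isUnit_det hy),
      Matrix.neg_apply]
  simp only [codiffTwo, hH.nablaTwo_fundamentalForm hy, codiff_eq, Finset.sum_neg_distrib, neg_neg]

theorem leeForm_eq (hy : y ∈ T) (l : Fin 4) : leeForm G A l y = ∑ i, jNablaJ G A i y i l := by
  have jNablaJ_eq (i : Fin 4) : jNablaJ G A i y = -(nablaJ G A i y * A y) := by
    rw [hH.nablaJ_anticomm hy, neg_neg, jNablaJ]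
  simp only [leeForm, hH.codiffTwo_fundamentalForm hy, jNablaJ_eq, Matrix.neg_apply,
    Matrix.mul_apply, Finset.sum_mul, Finset.sum_neg_distrib, mul_comm (A y _ l)]
  rw [Finset.sum_comm]

theorem leeVec_eq (hy : y ∈ T) (k : Fin 4) :
    leeVec G A y k = ∑ i, (jNablaJ G A i y * (G y)⁻¹) i k := by
  have inv_comm (l : Fin 4) : (G y)⁻¹ k l = (G y)⁻¹ l k := congr_fun₂ (hH.inv_transpose hy) l k
  simp only [leeVec, Matrix.mulVec, dotProduct, hH.leeForm_eq hy, Matrix.mul_apply,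
    Finset.sum_mul, inv_comm, mul_comm ((G y)⁻¹ _ k)]
  exact Finset.sum_comm

theorem leeVec_eq_neg (hy : y ∈ T) (k : Fin 4) :
    leeVec G A y k = -∑ i, (jNablaJ G A i y * (G y)⁻¹) k i := by
  rw [hH.leeVec_eq hy, ← Finset.sum_neg_distrib]
  exact Finset.sum_congr rfl fun i _ => congr_fun₂ (transpose_mul_inv_of_isSkewAdjoint
    (hH.transpose_eq hy) (hH.isUnit_det hy) (hH.isSkewAdjoint_jNablaJ hy i)) k i

theorem smooth_leeForm (l : Fin 4) : ContDiffOn ℝ ∞ (leeForm G A l) T :=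
  (ContDiffOn.sum fun i _ => hH.smooth_jNablaJ i i l).congr fun _ hz => hH.leeForm_eq hz l

theorem smooth_leeVec (k : Fin 4) : ContDiffOn ℝ ∞ (fun z => leeVec G A z k) T :=
  ContDiffOn.sum (s := Finset.univ) fun l _ => (hH.smooth_inv k l).mul (hH.smooth_leeForm l)

theorem smooth_betaForm : SmoothOn (betaForm G A) T := fun i j =>
  (hH.smooth_J.mul ((hH.smooth_nablaJ i).mul (hH.smooth_nablaJ j))).trace

theorem smooth_rhoForm : SmoothOn (rhoForm G A) T := fun i j =>
  (hH.smooth_J.mul (smoothOn_curvMat hH.isOpen hH.smooth_conn i j)).trace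

theorem smooth_contr (hβ : SmoothOn β T) : ContDiffOn ℝ ∞ (contr G A β) T :=
  (hβ.mul (hH.smooth_J.mul hH.smooth_inv).transpose).trace

end IsHermitianOn

end Coord

/-! ### Consequences of the first Gray condition -/

namespace Coord

open scoped Matrix

section Contraction

/-- The covariant derivative `(∇_{∂_m} Φ)(∂_i)` of the endomorphism-valued 1-form `Φ`. -/
def nablaEndOne (G : R4 → Matrix (Fin 4) (Fin 4) ℝ) (Φ : Fin 4 → R4 → Matrix (Fin 4) (Fin 4) ℝ)
    (m i : Fin 4) (y : R4) : Matrix (Fin 4) (Fin 4) ℝ :=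
  covDeriv (conn G) m (Φ i) y - ∑ p, conn G m y p i • Φ p y

variable {G : R4 → Matrix (Fin 4) (Fin 4) ℝ} {T : Set R4} {y : R4}
  {Φ : Fin 4 → R4 → Matrix (Fin 4) (Fin 4) ℝ} {α α' : Fin 4 → R4 → ℝ}

theorem codiffOne_congr (hT : IsOpen T) (hy : y ∈ T) (hα : ∀ i, Set.EqOn (α i) (α' i) T) :
    codiffOne G α y = codiffOne G α' y := by
  have nablaOne_eq (i j : Fin 4) : nablaOne G α i j y = nablaOne G α' i j y := by
    simp only [nablaOne, pderiv_congr hT hy (hα j), hα _ hy]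
  simp only [codiffOne, nablaOne_eq]

namespace IsMetricOn

variable (hG : IsMetricOn G T)
include hG

theorem isSkewAdjoint_nablaEndOne (hΦ : ∀ i, SmoothOn (Φ i) T)
    (hskew : ∀ i, ∀ z ∈ T, (G z).IsSkewAdjoint (Φ i z)) (hy : y ∈ T) (m i : Fin 4) :
    (G y).IsSkewAdjoint (nablaEndOne G Φ m i y) := by
  rw [← mem_skewAdjointMatricesSubmodule]
  exact sub_mem ((mem_skewAdjointMatricesSubmodule _ _).2
      (hG.isSkewAdjoint_covDeriv (hΦ i) (hskew i) hy m))
    (sum_mem fun p _ => Submodule.smul_mem _ _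
      ((mem_skewAdjointMatricesSubmodule _ _).2 (hskew p y hy)))

theorem nablaEndOne_sub (hy : y ∈ T) (m i : Fin 4) :
    nablaEndOne G Φ m i y - nablaEndOne G Φ i m y =
      covDeriv (conn G) m (Φ i) y - covDeriv (conn G) i (Φ m) y := by
  simp only [nablaEndOne, hG.conn_symm hy m i]
  abel

theorem nablaOne_contraction (hΦ : ∀ i, SmoothOn (Φ i) T) (hy : y ∈ T) (m l : Fin 4) :
    nablaOne G (fun l z => ∑ i, Φ i z i l) m l y = ∑ i, nablaEndOne G Φ m i y i l := by
  have pderiv_eq : pderiv m (fun z => ∑ i, Φ i z i l) y = ∑ i, mderiv m (Φ i) y i l :=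
    pderiv_sum _ m fun i _ => differentiableAt_of_contDiffOn hG.isOpen (hΦ i i l) hy
  have index_term : ∑ i, (conn G m y * Φ i y) i l = ∑ i, ∑ p, conn G m y p i * Φ p y i l := by
    simp only [Matrix.mul_apply]
    exact Finset.sum_comm
  have christoffel_term : ∑ k, christoffel G k m l y * ∑ i, Φ i y i k =
      ∑ i, (Φ i y * conn G m y) i l := by
    simp only [Matrix.mul_apply, Finset.mul_sum, mul_comm (Φ _ y _ _)]
    exact Finset.sum_comm
  simp only [nablaEndOne, covDeriv, Matrix.sub_apply, Matrix.add_apply, Matrix.sum_apply,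
    Matrix.smul_apply, smul_eq_mul, Finset.sum_sub_distrib, Finset.sum_add_distrib]
  rw [nablaOne, pderiv_eq, index_term, christoffel_term]
  ring

theorem two_mul_codiffOne_contraction (hΦ : ∀ i, SmoothOn (Φ i) T)
    (hskew : ∀ i, ∀ z ∈ T, (G z).IsSkewAdjoint (Φ i z)) (hy : y ∈ T) :
    2 * codiffOne G (fun l z => ∑ i, Φ i z i l) y =
      ∑ i, ∑ m, ((covDeriv (conn G) i (Φ m) y - covDeriv (conn G) m (Φ i) y) * (G y)⁻¹) i m := by
  set N := fun m i => nablaEndOne G Φ m i y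
  have codiff_eq : codiffOne G (fun l z => ∑ i, Φ i z i l) y =
      -∑ i, ∑ m, (N m i * (G y)⁻¹) i m := by
    have inv_comm (m l : Fin 4) : (G y)⁻¹ m l = (G y)⁻¹ l m :=
      congr_fun₂ (hG.inv_transpose hy) l m
    simp only [codiffOne, hG.nablaOne_contraction hΦ hy, Matrix.mul_apply, Finset.mul_sum]
    rw [Finset.sum_comm (γ := Fin 4) (f := fun i m => ∑ l, N m i i l * (G y)⁻¹ l m)]
    refine congrArg Neg.neg (Finset.sum_congr rfl fun m _ => Finset.sum_comm.trans ?_)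
    exact Finset.sum_congr rfl fun i _ => Finset.sum_congr rfl fun l _ => by
      rw [inv_comm m l, mul_comm]
  have codiff_eq_swap : codiffOne G (fun l z => ∑ i, Φ i z i l) y =
      ∑ i, ∑ m, (N i m * (G y)⁻¹) i m := by
    have swap (m i : Fin 4) : (N m i * (G y)⁻¹) m i = -(N m i * (G y)⁻¹) i m :=
      congr_fun₂ (transpose_mul_inv_of_isSkewAdjoint (hG.transpose_eq hy) (hG.isUnit_det hy)
        (hG.isSkewAdjoint_nablaEndOne hΦ hskew hy m i)) i m
    simp only [codiff_eq, swap, Finset.sum_neg_distrib]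
    rw [Finset.sum_comm]
  simp only [← hG.nablaEndOne_sub hy, Matrix.sub_mul, Matrix.sub_apply, Finset.sum_sub_distrib]
  linarith

theorem scalar_eq_sum (hy : y ∈ T) :
    scalar G y = ∑ j, ∑ i, (curvMat (conn G) i j y * (G y)⁻¹) i j := by
  have inv_comm (j k : Fin 4) : (G y)⁻¹ j k = (G y)⁻¹ k j :=
    congr_fun₂ (hG.inv_transpose hy) k j
  simp only [scalar, ricci, ← curvMat_conn_apply, Matrix.mul_apply, Finset.mul_sum]
  refine Finset.sum_congr rfl fun j _ => Finset.sum_comm.trans ?_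
  exact Finset.sum_congr rfl fun i _ => Finset.sum_congr rfl fun k _ => by
    rw [inv_comm j k, mul_comm]

end IsMetricOn

end Contraction

section GrayCondition

/-- A Hermitian structure on `T` all of whose curvature endomorphisms commute with the almost
complex structure; this is the first Gray condition. -/
structure IsGrayOn (G A : R4 → Matrix (Fin 4) (Fin 4) ℝ) (T : Set R4) : Prop
    extends IsHermitianOn G A T where
  comm : ∀ y ∈ T, ∀ i j, curvMat (conn G) i j y * A y = A y * curvMat (conn G) i j y

variable {G A : R4 → Matrix (Fin 4) (Fin 4) ℝ} {T : Set R4} {y : R4}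

theorem IsHermitianOn.isGrayOn (hH : IsHermitianOn G A T)
    (hR : ∀ y ∈ T, ∀ i j k l : Fin 4, riemann G i j k l y =
      ∑ m, ∑ n, A y m k * A y n l * riemann G i j m n y) : IsGrayOn G A T := by
  refine ⟨hH, fun y hy i j => ?_⟩
  set Ω := curvMat (conn G) i j y
  have gray : Ωᵀ * G y = (A y)ᵀ * (Ωᵀ * G y) * A y := by
    ext k l
    rw [← riemann_eq, hR y hy, mul_mul_apply_eq_sum]
    refine Finset.sum_congr rfl fun m _ => Finset.sum_congr rfl fun n _ => ?_
    rw [riemann_eq, Matrix.transpose_apply]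
    ring
  have skew_Ω : Ωᵀ * G y = G y * -Ω := hH.isSkewAdjoint_curvMat hy i j
  have skew_A : (A y)ᵀ * G y = G y * -A y := hH.isSkewAdjoint_J hy
  have conj_eq : G y * Ω = G y * -(A y * Ω * A y) := by
    rw [skew_Ω, ← Matrix.mul_assoc, skew_A] at gray
    rw [← neg_inj, ← Matrix.mul_neg, gray]
    noncomm_ring
  have Ω_eq : Ω = -(A y * Ω * A y) := by
    rw [← Matrix.nonsing_inv_mul_cancel_left _ (-_) (hH.isUnit_det hy), ← conj_eq,
      Matrix.nonsing_inv_mul_cancel_left _ _ (hH.isUnit_det hy)]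
  calc Ω * A y = -(A y * A y) * Ω * A y := by rw [hH.sq y hy, neg_neg, Matrix.one_mul]
    _ = A y * -(A y * Ω * A y) := by noncomm_ring
    _ = A y * Ω := by rw [← Ω_eq]

/-- A 2-form with components `β`, as a field of antisymmetric matrices, is closed on `T`. -/
def IsClosedTwoForm (β : R4 → Matrix (Fin 4) (Fin 4) ℝ) (T : Set R4) : Prop :=
  ∀ y ∈ T, ∀ i j k, mderiv i β y j k + mderiv j β y k i + mderiv k β y i j = 0

/-- The derivative `∑ v^k ∂_k f` of `f` in the direction `v`. -/
def dirDeriv (v : Fin 4 → ℝ) (f : R4 → ℝ) (y : R4) : ℝ :=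
  ∑ k, v k * pderiv k f y

theorem IsClosedTwoForm.dirDeriv_smul_eq {ρ β : R4 → Matrix (Fin 4) (Fin 4) ℝ} {q r : R4 → ℝ}
    {v : Fin 4 → ℝ} (hT : IsOpen T) (hρ : IsClosedTwoForm ρ T) (hβ : IsClosedTwoForm β T)
    (hρs : SmoothOn ρ T) (hβs : SmoothOn β T) (hr : ContDiffOn ℝ ∞ r T) (hq : ContDiffOn ℝ ∞ q T)
    (heq : ∀ z ∈ T, r z • β z = q z • ρ z) (hρT : (ρ y)ᵀ = -ρ y) (hy : y ∈ T)
    (hv : ρ y *ᵥ v = 0) :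
    (r y * dirDeriv v q y) • ρ y = (q y * dirDeriv v r y) • ρ y := by
  have leibniz (k i j : Fin 4) : pderiv k r y * β y i j + r y * mderiv k β y i j =
      pderiv k q y * ρ y i j + q y * mderiv k ρ y i j := by
    have diff {f : R4 → ℝ} (hf : ContDiffOn ℝ ∞ f T) := differentiableAt_of_contDiffOn hT hf hy
    rw [mderiv_apply, mderiv_apply, ← pderiv_mul k (diff hr) (diff (hβs i j)),
      ← pderiv_mul k (diff hq) (diff (hρs i j))]
    exact pderiv_congr hT hy fun z hz => congr_fun₂ (heq z hz) i j
  set η := fun k => r y * pderiv k q y - q y * pderiv k r y with hη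
  have η_wedge (i j k : Fin 4) : η i * ρ y j k + η j * ρ y k i + η k * ρ y i j = 0 := by
    have proportional (i j : Fin 4) : r y * β y i j = q y * ρ y i j := congr_fun₂ (heq y hy) i j
    linear_combination pderiv i r y * proportional j k + pderiv j r y * proportional k i
      + pderiv k r y * proportional i j - r y * (leibniz i j k + leibniz j k i + leibniz k i j)
      + r y * r y * hβ y hy i j k - r y * q y * hρ y hy i j k
  have contract (i : Fin 4) : ∑ k, ρ y i k * v k = 0 := congrFun hv i
  ext i j
  have ρ_swap (k : Fin 4) : ρ y k i = -ρ y i k := congr_fun₂ hρT i k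
  have sum_wedge : ∑ k, v k * (η i * ρ y j k + η j * ρ y k i + η k * ρ y i j) =
      η i * (∑ k, ρ y j k * v k) - η j * (∑ k, ρ y i k * v k) + (∑ k, v k * η k) * ρ y i j := by
    rw [Finset.mul_sum, Finset.mul_sum, Finset.sum_mul, ← Finset.sum_sub_distrib,
      ← Finset.sum_add_distrib]
    refine Finset.sum_congr rfl fun k _ => ?_
    rw [ρ_swap k]
    ring
  have sum_η : ∑ k, v k * η k = r y * dirDeriv v q y - q y * dirDeriv v r y := by
    simp only [dirDeriv, hη, Finset.mul_sum, ← Finset.sum_sub_distrib]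
    exact Finset.sum_congr rfl fun k _ => by ring
  simp only [η_wedge, contract, mul_zero, Finset.sum_const_zero, sum_η] at sum_wedge
  simp only [Matrix.smul_apply, smul_eq_mul]
  linarith

namespace IsGrayOn

variable (hA : IsGrayOn G A T)
include hA

theorem covDeriv_nablaJ_symm (hy : y ∈ T) (i j : Fin 4) :
    covDeriv (conn G) i (nablaJ G A j) y = covDeriv (conn G) j (nablaJ G A i) y := by
  rw [← sub_eq_zero]
  exact (covDeriv_covDeriv_sub hA.isOpen hA.smooth_conn hA.smooth_J hy i j).trans
    (sub_eq_zero.2 (hA.comm y hy i j))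

theorem commutator_nablaJ (hy : y ∈ T) (i j : Fin 4) :
    nablaJ G A i y * nablaJ G A j y - nablaJ G A j y * nablaJ G A i y =
      (-(1 / 2) * betaForm G A y i j) • A y :=
  commutator_anticomm (hA.posDef y hy) (hA.sq y hy) (hA.orthogonal y hy)
    (hA.isSkewAdjoint_nablaJ hy i) (hA.nablaJ_anticomm hy i) (hA.isSkewAdjoint_nablaJ hy j)
    (hA.nablaJ_anticomm hy j)

theorem commutator_curvMat_nablaJ (hy : y ∈ T) (i j k : Fin 4) :
    curvMat (conn G) i j y * nablaJ G A k y - nablaJ G A k y * curvMat (conn G) i j y =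
      (-(1 / 2) * rhoForm G A y i j) • jNablaJ G A k y :=
  commutator_comm_anticomm (hA.posDef y hy) (hA.sq y hy) (hA.orthogonal y hy)
    (hA.isSkewAdjoint_curvMat hy i j) (hA.comm y hy i j) (hA.isSkewAdjoint_nablaJ hy k)
    (hA.nablaJ_anticomm hy k)

theorem cyclic_commutator (hy : y ∈ T) (i j k : Fin 4) :
    (curvMat (conn G) i j y * nablaJ G A k y - nablaJ G A k y * curvMat (conn G) i j y)
      + (curvMat (conn G) j k y * nablaJ G A i y - nablaJ G A i y * curvMat (conn G) j k y)
      + (curvMat (conn G) k i y * nablaJ G A j y - nablaJ G A j y * curvMat (conn G) k i y)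
      = 0 := by
  have hB := hA.smooth_nablaJ
  have ricci_identity (i j k : Fin 4) :=
    covDeriv_covDeriv_sub hA.isOpen hA.smooth_conn (hB k) hy i j
  have inner_symm (i j k : Fin 4) :
      covDeriv (conn G) i (covDeriv (conn G) j (nablaJ G A k)) y =
        covDeriv (conn G) i (covDeriv (conn G) k (nablaJ G A j)) y :=
    covDeriv_congr hA.isOpen hy fun z hz => hA.covDeriv_nablaJ_symm hz j k
  rw [← ricci_identity i j k, ← ricci_identity j k i, ← ricci_identity k i j, inner_symm i j k,
    inner_symm j k i, inner_symm k i j]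
  abel

theorem rhoForm_wedge_jNablaJ (hy : y ∈ T) (i j k : Fin 4) :
    rhoForm G A y i j • jNablaJ G A k y + rhoForm G A y j k • jNablaJ G A i y
      + rhoForm G A y k i • jNablaJ G A j y = 0 := by
  have cyclic := hA.cyclic_commutator hy i j k
  simp only [hA.commutator_curvMat_nablaJ hy, mul_smul, ← smul_add] at cyclic
  exact (smul_eq_zero.1 cyclic).resolve_left (by norm_num)

theorem rhoForm_wedge_betaForm (hy : y ∈ T) (i j k l : Fin 4) :
    rhoForm G A y i j * betaForm G A y k l + rhoForm G A y j k * betaForm G A y i l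
      + rhoForm G A y k i * betaForm G A y j l = 0 := by
  have traced := congrArg (fun X => (X * nablaJ G A l y).trace) (hA.rhoForm_wedge_jNablaJ hy i j k)
  simp only [Matrix.add_mul, Matrix.smul_mul, Matrix.trace_add, Matrix.trace_smul, smul_eq_mul,
    Matrix.zero_mul, Matrix.trace_zero, jNablaJ, Matrix.mul_assoc] at traced
  exact traced

theorem contr_rhoForm_smul_betaForm (hy : y ∈ T) :
    contr G A (rhoForm G A) y • betaForm G A y = contr G A (betaForm G A) y • rhoForm G A y :=
  trace_smul_eq_of_wedge_eq_zero (rhoForm_transpose G A y) (hA.betaForm_transpose hy)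
    (hA.bivec_transpose hy) (hA.rhoForm_wedge_betaForm hy)

theorem covDeriv_jNablaJ_sub (hy : y ∈ T) (i j : Fin 4) :
    covDeriv (conn G) i (jNablaJ G A j) y - covDeriv (conn G) j (jNablaJ G A i) y =
      (-(1 / 2) * betaForm G A y i j) • A y := by
  have leibniz (i j : Fin 4) : covDeriv (conn G) i (jNablaJ G A j) y =
      nablaJ G A i y * nablaJ G A j y + A y * covDeriv (conn G) i (nablaJ G A j) y :=
    covDeriv_mul hA.isOpen hA.smooth_J (hA.smooth_nablaJ j) hy i
  rw [← hA.commutator_nablaJ hy, leibniz i j, leibniz j i, hA.covDeriv_nablaJ_symm hy i j]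
  abel

theorem codiffOne_leeForm (hy : y ∈ T) :
    codiffOne G (leeForm G A) y = -(1 / 4) * contr G A (betaForm G A) y := by
  have two_mul_codiff := hA.two_mul_codiffOne_contraction hA.smooth_jNablaJ
    (fun i z hz => hA.isSkewAdjoint_jNablaJ hz i) hy
  rw [← codiffOne_congr hA.isOpen hy fun l z hz => hA.leeForm_eq hz l] at two_mul_codiff
  simp only [hA.covDeriv_jNablaJ_sub hy, Matrix.smul_mul, Matrix.smul_apply, smul_eq_mul,
    mul_assoc, ← Finset.mul_sum] at two_mul_codiff
  have contr_eq : contr G A (betaForm G A) y =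
      ∑ i, ∑ m, betaForm G A y i m * (A y * (G y)⁻¹) i m := rfl
  linear_combination (1 / 2) * two_mul_codiff + (1 / 4) * contr_eq

theorem isClosedTwoForm_rhoForm : IsClosedTwoForm (rhoForm G A) T := by
  intro y hy i j k
  have hΩ := smoothOn_curvMat hA.isOpen hA.smooth_conn
  have trace_eq_zero (i j k : Fin 4) :
      (nablaJ G A i y * curvMat (conn G) j k y).trace = 0 := by
    refine trace_eq_zero_of_anticomm (hA.sq y hy) ?_
    rw [mul_assoc, hA.comm y hy, ← mul_assoc, hA.nablaJ_anticomm hy, neg_mul, mul_assoc]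
  have mderiv_eq (i j k : Fin 4) : mderiv i (rhoForm G A) y j k =
      (A y * covDeriv (conn G) i (curvMat (conn G) j k) y).trace := by
    refine (pderiv_trace_eq_trace_covDeriv (Γ := conn G) hA.isOpen
      (hA.smooth_J.mul (hΩ j k)) hy i).trans ?_
    rw [covDeriv_mul hA.isOpen hA.smooth_J (hΩ j k) hy, Matrix.trace_add]
    exact (congrArg (· + _) (trace_eq_zero i j k)).trans (zero_add _)
  rw [mderiv_eq, mderiv_eq, mderiv_eq, ← Matrix.trace_add, ← Matrix.trace_add, ← Matrix.mul_add,
    ← Matrix.mul_add, covDeriv_curvMat_bianchi hA.isOpen hA.smooth_conn hy, Matrix.mul_zero,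
    Matrix.trace_zero]

theorem isClosedTwoForm_betaForm : IsClosedTwoForm (betaForm G A) T := by
  intro y hy i j k
  have hB := hA.smooth_nablaJ
  have trace_eq_zero (i j k : Fin 4) :
      (nablaJ G A i y * (nablaJ G A j y * nablaJ G A k y)).trace = 0 := by
    have anticomm (i : Fin 4) := hA.nablaJ_anticomm hy i
    refine trace_eq_zero_of_anticomm (hA.sq y hy) ?_
    rw [mul_assoc, mul_assoc, anticomm k, mul_neg, ← mul_assoc _ (A y), anticomm j, neg_mul,
      neg_neg, mul_assoc (A y), ← mul_assoc _ (A y), anticomm i, neg_mul, mul_assoc]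
  have mderiv_eq (i j k : Fin 4) : mderiv i (betaForm G A) y j k =
      (A y * (covDeriv (conn G) i (nablaJ G A j) y * nablaJ G A k y)).trace
        - (A y * (covDeriv (conn G) i (nablaJ G A k) y * nablaJ G A j y)).trace := by
    refine (pderiv_trace_eq_trace_covDeriv (Γ := conn G) hA.isOpen
      (hA.smooth_J.mul ((hB j).mul (hB k))) hy i).trans ?_
    rw [covDeriv_mul hA.isOpen hA.smooth_J ((hB j).mul (hB k)) hy,
      covDeriv_mul hA.isOpen (hB j) (hB k) hy, Matrix.trace_add, Matrix.mul_add,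
      Matrix.trace_add, hA.trace_mul_nablaJ_mul hy _ j, ← sub_eq_add_neg]
    exact (congrArg (· + _) (trace_eq_zero i j k)).trans (zero_add _)
  rw [mderiv_eq, mderiv_eq, mderiv_eq, hA.covDeriv_nablaJ_symm hy i j,
    hA.covDeriv_nablaJ_symm hy j k, hA.covDeriv_nablaJ_symm hy k i]
  ring

theorem contr_rhoForm (hy : y ∈ T) : contr G A (rhoForm G A) y = -2 * scalar G y := by
  set F : Matrix (Fin 4) (Fin 4) ℝ :=
    Matrix.of fun i j => ∑ k, (A y * curvMat (conn G) k i y) k j with hF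
  have rhoForm_eq : rhoForm G A y = Fᵀ - F := by
    ext i j
    simp only [rhoForm, hF, Matrix.of_apply, Matrix.trace, Matrix.diag, Matrix.sub_apply,
      Matrix.transpose_apply, Matrix.mul_apply, ← Finset.sum_sub_distrib, ← mul_sub]
    refine Finset.sum_congr rfl fun k _ => Finset.sum_congr rfl fun l _ => ?_
    have swap := congr_fun₂ (curvMat_swap (Γ := conn G) j k y) l i
    rw [Matrix.neg_apply] at swap
    rw [swap]
    linear_combination A y k l * hA.curvMat_bianchi hy i j k l
  have conj_curvMat (k i : Fin 4) :
      A y * curvMat (conn G) k i y * bivec G A y = -(curvMat (conn G) k i y * (G y)⁻¹) := by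
    rw [← hA.comm y hy, bivec, mul_assoc, ← mul_assoc (A y), hA.sq y hy, neg_one_mul, mul_neg]
  have trace_eq : (F * bivec G A y).trace = -scalar G y := by
    have F_mul (i : Fin 4) : (F * bivec G A y) i i =
        ∑ k, (A y * curvMat (conn G) k i y * bivec G A y) k i := by
      simp only [hF, Matrix.mul_apply (N := bivec G A y), Matrix.of_apply, Finset.sum_mul]
      exact Finset.sum_comm
    simp only [Matrix.trace, Matrix.diag, F_mul, conj_curvMat, Matrix.neg_apply,
      Finset.sum_neg_distrib, hA.scalar_eq_sum hy]
  have bivec_eq := hA.bivec_transpose hy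
  rw [contr, rhoForm_eq, Matrix.sub_mul, Matrix.trace_sub, ← Matrix.transpose_mul,
    Matrix.trace_transpose, Matrix.trace_mul_comm, bivec_eq, Matrix.mul_neg, Matrix.trace_neg,
    trace_eq]
  ring

theorem rhoForm_J_invariant (hy : y ∈ T) :
    (A y)ᵀ * rhoForm G A y * A y = rhoForm G A y := by
  have rhoForm_eq : rhoForm G A y =
      ∑ k, ∑ l, bivec G A y k l • (G y * curvMat (conn G) k l y)ᵀ := by
    ext i j
    have A_mul : A y * curvMat (conn G) i j y = bivec G A y * (G y * curvMat (conn G) i j y) := by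
      rw [bivec, ← mul_assoc, Matrix.nonsing_inv_mul_cancel_right _ _ (hA.isUnit_det hy)]
    simp only [Matrix.of_apply, rhoForm, A_mul, Matrix.trace, Matrix.diag,
      Matrix.mul_apply (M := bivec G A y), Matrix.sum_apply, Matrix.smul_apply, smul_eq_mul,
      Matrix.transpose_apply, hA.mul_curvMat_pair_symm hy i j]
  have curvature_invariant (k l : Fin 4) :
      (A y)ᵀ * (G y * curvMat (conn G) k l y)ᵀ * A y = (G y * curvMat (conn G) k l y)ᵀ := by
    have skew_A : (A y)ᵀ * G y = G y * -A y := hA.isSkewAdjoint_J hy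
    rw [← Matrix.transpose_inj]
    simp only [Matrix.transpose_mul, Matrix.transpose_transpose]
    rw [← mul_assoc, ← mul_assoc, skew_A, mul_assoc, hA.comm y hy, mul_neg, neg_mul, mul_assoc,
      ← mul_assoc (A y), hA.sq y hy, neg_one_mul, mul_neg, neg_neg]
  simp only [rhoForm_eq, Finset.mul_sum, Finset.sum_mul, Matrix.mul_smul, Matrix.smul_mul,
    curvature_invariant]

theorem trace_rhoForm_mul_jNablaJ (hy : y ∈ T) (j : Fin 4) :
    (rhoForm G A y * (jNablaJ G A j y * (G y)⁻¹)).trace = 0 := by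
  have jNablaJ_conj : A y * jNablaJ G A j y * A y = jNablaJ G A j y := by
    rw [jNablaJ, mul_assoc, mul_assoc, hA.nablaJ_anticomm hy, mul_neg, mul_neg,
      ← mul_assoc (A y) (A y), hA.sq y hy, neg_one_mul, neg_neg]
  have bivector_conj : A y * (jNablaJ G A j y * (G y)⁻¹) * (A y)ᵀ =
      -(jNablaJ G A j y * (G y)⁻¹) := by
    have bivec_eq : (G y)⁻¹ * (A y)ᵀ = -(A y * (G y)⁻¹) := by
      rw [← hA.inv_transpose hy, ← Matrix.transpose_mul, hA.inv_transpose hy]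
      exact hA.bivec_transpose hy
    rw [mul_assoc, mul_assoc, bivec_eq, mul_neg, mul_neg, ← mul_assoc, ← mul_assoc, jNablaJ_conj]
  have trace_eq_neg : (rhoForm G A y * (jNablaJ G A j y * (G y)⁻¹)).trace =
      -(rhoForm G A y * (jNablaJ G A j y * (G y)⁻¹)).trace := by
    conv_lhs => rw [← hA.rhoForm_J_invariant hy]
    rw [mul_assoc, mul_assoc, Matrix.trace_mul_comm, mul_assoc, bivector_conj, mul_neg,
      Matrix.trace_neg]
  linarith

theorem rhoForm_mulVec_leeVec (hy : y ∈ T) : rhoForm G A y *ᵥ leeVec G A y = 0 := by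
  ext j
  set X := fun k => jNablaJ G A k y * (G y)⁻¹
  have wedge (i k : Fin 4) : rhoForm G A y i j * X k i k + rhoForm G A y j k * X i i k
      + rhoForm G A y k i * X j i k = 0 := by
    have applied := congrArg (fun Y => (Y * (G y)⁻¹) i k) (hA.rhoForm_wedge_jNablaJ hy i j k)
    simpa only [Matrix.add_mul, Matrix.smul_mul, Matrix.add_apply, Matrix.smul_apply, smul_eq_mul,
      Matrix.zero_mul, Matrix.zero_apply] using applied
  have first_term : ∑ i, ∑ k, rhoForm G A y i j * X k i k =
      (rhoForm G A y *ᵥ leeVec G A y) j := by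
    change _ = ∑ k, rhoForm G A y j k * leeVec G A y k
    refine Finset.sum_congr rfl fun i _ => ?_
    have swap : rhoForm G A y i j = -rhoForm G A y j i :=
      congr_fun₂ (rhoForm_transpose G A y) j i
    rw [hA.leeVec_eq_neg hy, ← Finset.mul_sum, swap, neg_mul, mul_neg]
  have second_term :
      ∑ i, ∑ k, rhoForm G A y j k * X i i k = (rhoForm G A y *ᵥ leeVec G A y) j := by
    change _ = ∑ k, rhoForm G A y j k * leeVec G A y k
    rw [Finset.sum_comm]
    refine Finset.sum_congr rfl fun k _ => ?_
    rw [hA.leeVec_eq hy, ← Finset.mul_sum]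
  have third_term : ∑ i, ∑ k, rhoForm G A y k i * X j i k = 0 := by
    rw [Finset.sum_comm]
    exact hA.trace_rhoForm_mul_jNablaJ hy j
  have sum_wedge : ∑ i, ∑ k, (rhoForm G A y i j * X k i k + rhoForm G A y j k * X i i k
      + rhoForm G A y k i * X j i k) = 0 := by
    simp only [wedge, Finset.sum_const_zero]
  simp only [Finset.sum_add_distrib, first_term, second_term, third_term] at sum_wedge
  rw [Pi.zero_apply]
  linarith

theorem contr_rhoForm_mul_dirDeriv (hy : y ∈ T) (hr : contr G A (rhoForm G A) y ≠ 0) :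
    contr G A (rhoForm G A) y * dirDeriv (leeVec G A y) (contr G A (betaForm G A)) y =
      contr G A (betaForm G A) y * dirDeriv (leeVec G A y) (contr G A (rhoForm G A)) y := by
  have derivation := IsClosedTwoForm.dirDeriv_smul_eq hA.isOpen hA.isClosedTwoForm_rhoForm
    hA.isClosedTwoForm_betaForm hA.smooth_rhoForm hA.smooth_betaForm
    (hA.smooth_contr hA.smooth_rhoForm) (hA.smooth_contr hA.smooth_betaForm)
    (fun z hz => hA.contr_rhoForm_smul_betaForm hz) (rhoForm_transpose G A y) hy
    (hA.rhoForm_mulVec_leeVec hy)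
  have rhoForm_ne_zero : rhoForm G A y ≠ 0 := by
    intro h
    rw [contr, h, Matrix.zero_mul, Matrix.trace_zero] at hr
    exact hr rfl
  exact smul_left_injective ℝ rhoForm_ne_zero derivation

end IsGrayOn

end GrayCondition

end Coord

/-! ### The Riemannian density -/

namespace Coord

open scoped Matrix

section Divergence

/-- The density `√det g` of the Riemannian measure with respect to Lebesgue measure. -/
def density (G : R4 → Matrix (Fin 4) (Fin 4) ℝ) (y : R4) : ℝ := Real.sqrt (G y).det

namespace IsMetricOn

variable {G : R4 → Matrix (Fin 4) (Fin 4) ℝ} {T : Set R4} {y : R4} {α : Fin 4 → R4 → ℝ}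
  (hG : IsMetricOn G T)
include hG

theorem density_pos (hy : y ∈ T) : 0 < density G y :=
  Real.sqrt_pos.2 (hG.posDef y hy).det_pos

theorem smooth_density : ContDiffOn ℝ ∞ (density G) T :=
  hG.smooth.det.sqrt fun _ => hG.det_ne_zero

theorem pderiv_det_eq (hy : y ∈ T) (k : Fin 4) :
    pderiv k (fun z => (G z).det) y = 2 * (G y).det * (conn G k y).trace := by
  have trace_left : ((G y).adjugate * ((conn G k y)ᵀ * G y)).trace =
      (G y).det * (conn G k y).trace := by
    rw [Matrix.trace_mul_comm, Matrix.mul_assoc, Matrix.mul_adjugate, Matrix.mul_smul,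
      Matrix.mul_one, Matrix.trace_smul, Matrix.trace_transpose, smul_eq_mul]
  have trace_right : ((G y).adjugate * (G y * conn G k y)).trace =
      (G y).det * (conn G k y).trace := by
    rw [← Matrix.mul_assoc, Matrix.adjugate_mul, Matrix.smul_mul, Matrix.one_mul,
      Matrix.trace_smul, smul_eq_mul]
  rw [pderiv_det hG.isOpen hG.smooth hy, hG.mderiv_eq_conn hy, Matrix.mul_add, Matrix.trace_add,
    trace_left, trace_right]
  ring

theorem pderiv_density (hy : y ∈ T) (k : Fin 4) :
    pderiv k (density G) y = density G y * (conn G k y).trace := by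
  have sq_density {z : R4} (hz : z ∈ T) : density G z * density G z = (G z).det :=
    Real.mul_self_sqrt (hG.posDef z hz).det_pos.le
  have hd := differentiableAt_of_contDiffOn hG.isOpen hG.smooth_density hy
  have hderiv := pderiv_mul k hd hd
  rw [pderiv_congr (h := fun z => (G z).det) hG.isOpen hy fun z => sq_density,
    hG.pderiv_det_eq hy, ← sq_density hy] at hderiv
  refine mul_left_cancel₀ (hG.density_pos hy).ne' ?_
  linarith

theorem mderiv_inv (hy : y ∈ T) (k : Fin 4) :
    mderiv k (fun z => (G z)⁻¹) y = -((G y)⁻¹ * (conn G k y)ᵀ) - conn G k y * (G y)⁻¹ := by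
  have hu := hG.isUnit_det hy
  have hderiv := mderiv_mul hG.isOpen hG.smooth_inv hG.smooth hy k
  rw [mderiv_congr (H := fun _ => 1) hG.isOpen hy
    fun z hz => Matrix.nonsing_inv_mul _ (hG.isUnit_det hz), mderiv_const,
    hG.mderiv_eq_conn hy] at hderiv
  calc mderiv k (fun z => (G z)⁻¹) y
      = mderiv k (fun z => (G z)⁻¹) y * G y * (G y)⁻¹ :=
        (Matrix.mul_nonsing_inv_cancel_right _ _ hu).symm
    _ = -((G y)⁻¹ * ((conn G k y)ᵀ * G y + G y * conn G k y)) * (G y)⁻¹ := by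
        rw [eq_neg_of_add_eq_zero_left hderiv.symm]
    _ = -((G y)⁻¹ * (conn G k y)ᵀ * (G y * (G y)⁻¹))
          - ((G y)⁻¹ * G y) * conn G k y * (G y)⁻¹ := by noncomm_ring
    _ = -((G y)⁻¹ * (conn G k y)ᵀ) - conn G k y * (G y)⁻¹ := by
        rw [Matrix.mul_nonsing_inv _ hu, Matrix.nonsing_inv_mul _ hu, Matrix.mul_one,
          Matrix.one_mul]

theorem sum_conn_mulVec (hy : y ∈ T) (v : Fin 4 → ℝ) :
    ∑ k, (conn G k y *ᵥ v) k = ∑ k, (conn G k y).trace * v k := by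
  simp only [Matrix.mulVec, dotProduct, Matrix.trace, Matrix.diag, Finset.sum_mul]
  rw [Finset.sum_comm]
  simp only [hG.conn_symm hy]

theorem sum_pderiv_inv_mulVec (hα : ∀ l, ContDiffOn ℝ ∞ (α l) T) (hy : y ∈ T) :
    ∑ k, pderiv k (fun z => ((G z)⁻¹ *ᵥ fun l => α l z) k) y =
      -codiffOne G α y - ∑ k, (conn G k y).trace * ((G y)⁻¹ *ᵥ fun l => α l y) k := by
  have diff_α (l : Fin 4) := differentiableAt_of_contDiffOn hG.isOpen (hα l) hy
  have diff_inv (k l : Fin 4) := hG.smooth_inv.differentiableAt hG.isOpen hy k l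
  have expand (k : Fin 4) : pderiv k (fun z => ((G z)⁻¹ *ᵥ fun l => α l z) k) y =
      ∑ l, (G y)⁻¹ k l * (pderiv k (α l) y - ((conn G k y)ᵀ *ᵥ fun l => α l y) l)
        - (conn G k y *ᵥ ((G y)⁻¹ *ᵥ fun l => α l y)) k := by
    calc pderiv k (fun z => ∑ l, (G z)⁻¹ k l * α l z) y
        = ∑ l, (G y)⁻¹ k l * pderiv k (α l) y
          + (mderiv k (fun z => (G z)⁻¹) y *ᵥ fun l => α l y) k := by
          rw [pderiv_sum _ _ fun l _ => (diff_inv k l).fun_mul (diff_α l), Matrix.mulVec,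
            dotProduct, ← Finset.sum_add_distrib]
          exact Finset.sum_congr rfl fun l _ => by
            rw [pderiv_mul k (diff_inv k l) (diff_α l), mderiv_apply, add_comm]
      _ = _ := by
          rw [hG.mderiv_inv hy, Matrix.sub_mulVec, Matrix.neg_mulVec, Pi.sub_apply, Pi.neg_apply,
            Matrix.mulVec_mulVec, ← Matrix.mulVec_mulVec _ _ (conn G k y)ᵀ]
          simp only [mul_sub, Finset.sum_sub_distrib, Matrix.mulVec, dotProduct]
          ring
  simp only [expand, Finset.sum_sub_distrib, hG.sum_conn_mulVec hy, codiffOne, neg_neg]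
  rfl

theorem sum_pderiv_density_mul (hα : ∀ l, ContDiffOn ℝ ∞ (α l) T) (hy : y ∈ T) :
    ∑ k, pderiv k (fun z => density G z * ((G z)⁻¹ *ᵥ fun l => α l z) k) y =
      -(density G y * codiffOne G α y) := by
  have diff_α (l : Fin 4) := differentiableAt_of_contDiffOn hG.isOpen (hα l) hy
  have diff_inv (k l : Fin 4) := hG.smooth_inv.differentiableAt hG.isOpen hy k l
  have diff_raise (k : Fin 4) :
      DifferentiableAt ℝ (fun z => ((G z)⁻¹ *ᵥ fun l => α l z) k) y := by
    simp only [Matrix.mulVec, dotProduct]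
    exact DifferentiableAt.fun_sum fun l _ => (diff_inv k l).fun_mul (diff_α l)
  have diff_density := differentiableAt_of_contDiffOn hG.isOpen hG.smooth_density hy
  simp only [pderiv_mul _ diff_density (diff_raise _), hG.pderiv_density hy, mul_assoc,
    ← Finset.mul_sum, Finset.sum_add_distrib, hG.sum_pderiv_inv_mulVec hα hy]
  ring

end IsMetricOn

end Divergence

section CoordinateChange

/-- The Jacobian matrix of a map between coordinate domains. -/
def jacobian (τ : R4 → R4) (y : R4) : Matrix (Fin 4) (Fin 4) ℝ :=
  Matrix.of fun a i => pderiv i (fun z => τ z a) y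

variable {τ : R4 → R4} {y : R4} {T T' : Set R4}

theorem fderiv_single_apply (hτ : DifferentiableAt ℝ τ y) (a i : Fin 4) :
    fderiv ℝ τ y (EuclideanSpace.single i 1) a = jacobian τ y a i := by
  have hcoord : HasFDerivAt (fun z => τ z a) ((EuclideanSpace.proj a).comp (fderiv ℝ τ y)) y :=
    (EuclideanSpace.proj (𝕜 := ℝ) a).hasFDerivAt.comp y hτ.hasFDerivAt
  rw [jacobian, Matrix.of_apply, pderiv, hcoord.fderiv]
  rfl

theorem fderiv_single_eq_sum (hτ : DifferentiableAt ℝ τ y) (i : Fin 4) :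
    fderiv ℝ τ y (EuclideanSpace.single i 1) =
      ∑ a, jacobian τ y a i • (EuclideanSpace.single a (1 : ℝ) : R4) := by
  ext b
  rw [fderiv_single_apply hτ]
  simp [Finset.sum_apply, Pi.single_apply]

theorem pderiv_comp {f : R4 → ℝ} (hτ : DifferentiableAt ℝ τ y)
    (hf : DifferentiableAt ℝ f (τ y)) (i : Fin 4) :
    pderiv i (fun z => f (τ z)) y = ∑ a, jacobian τ y a i * pderiv a f (τ y) := by
  have chain : pderiv i (fun z => f (τ z)) y =
      fderiv ℝ f (τ y) (fderiv ℝ τ y (EuclideanSpace.single i 1)) :=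
    DFunLike.congr_fun (hf.hasFDerivAt.comp y hτ.hasFDerivAt).fderiv _
  rw [chain, fderiv_single_eq_sum hτ, map_sum]
  simp only [map_smul, smul_eq_mul, pderiv]

variable (hT : IsOpen T) (hτ : ContDiffOn ℝ ∞ τ T)
include hT hτ

theorem smoothOn_jacobian : SmoothOn (jacobian τ) T := fun a i =>
  contDiffOn_pderiv hT ((EuclideanSpace.proj (𝕜 := ℝ) a).contDiff.comp_contDiffOn hτ) i

theorem mderiv_jacobian_comm (hy : y ∈ T) (i j a : Fin 4) :
    mderiv i (jacobian τ) y a j = mderiv j (jacobian τ) y a i :=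
  pderiv_comm hT ((EuclideanSpace.proj (𝕜 := ℝ) a).contDiff.comp_contDiffOn hτ) hy i j

omit hT in
theorem SmoothOn.comp {m n : Type*} {F : R4 → Matrix m n ℝ} (hF : SmoothOn F T')
    (hmaps : Set.MapsTo τ T T') : SmoothOn (fun z => F (τ z)) T :=
  fun a b => (hF a b).comp hτ hmaps

theorem mderiv_comp {m n : Type*} {F : R4 → Matrix m n ℝ} (hT' : IsOpen T')
    (hmaps : Set.MapsTo τ T T') (hF : SmoothOn F T') (hy : y ∈ T) (i : Fin 4) :
    mderiv i (fun z => F (τ z)) y = ∑ a, jacobian τ y a i • mderiv a F (τ y) := by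
  have hτy : DifferentiableAt ℝ τ y :=
    (hτ.contDiffAt (hT.mem_nhds hy)).differentiableAt (by simp)
  ext b c
  rw [mderiv_apply, pderiv_comp (f := fun z => F z b c) hτy
    (hF.differentiableAt hT' (hmaps hy) b c), Matrix.sum_apply]
  rfl

end CoordinateChange

section PullbackConnection

variable {n : Type*} {τ : R4 → R4} {y : R4} {T T' : Set R4} {Γ : Fin 4 → R4 → Matrix n n ℝ}

/-- The pullback along `τ` of the connection `d + Γ`. -/
def pullbackConn (τ : R4 → R4) (Γ : Fin 4 → R4 → Matrix n n ℝ) (i : Fin 4) (y : R4) :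
    Matrix n n ℝ :=
  ∑ a, jacobian τ y a i • Γ a (τ y)

variable (hT : IsOpen T) (hτ : ContDiffOn ℝ ∞ τ T) (hmaps : Set.MapsTo τ T T')
include hT hτ hmaps

theorem smoothOn_pullbackConn (hΓ : ∀ a, SmoothOn (Γ a) T') (i : Fin 4) :
    SmoothOn (pullbackConn τ Γ i) T := by
  intro b c
  simp only [pullbackConn, Matrix.sum_apply]
  exact ContDiffOn.sum fun a _ =>
    (smoothOn_jacobian hT hτ a i).mul ((hΓ a).comp hτ hmaps b c)

variable (hT' : IsOpen T')
include hT'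

theorem covDeriv_pullbackConn [Fintype n] {X : R4 → Matrix n n ℝ} (hX : SmoothOn X T')
    (hy : y ∈ T) (i : Fin 4) :
    covDeriv (pullbackConn τ Γ) i (fun z => X (τ z)) y =
      ∑ a, jacobian τ y a i • covDeriv Γ a X (τ y) := by
  simp only [covDeriv, pullbackConn, mderiv_comp hT hτ hT' hmaps hX hy, Finset.sum_mul,
    Finset.mul_sum, Matrix.smul_mul, Matrix.mul_smul, smul_add, smul_sub, Finset.sum_add_distrib,
    Finset.sum_sub_distrib]

theorem mderiv_pullbackConn (hΓ : ∀ a, SmoothOn (Γ a) T') (hy : y ∈ T) (i j : Fin 4) :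
    mderiv i (pullbackConn τ Γ j) y = ∑ a, mderiv i (jacobian τ) y a j • Γ a (τ y)
      + ∑ a, ∑ b, (jacobian τ y a j * jacobian τ y b i) • mderiv b (Γ a) (τ y) := by
  have diff_jacobian (a : Fin 4) := (smoothOn_jacobian hT hτ).differentiableAt hT hy a j
  have diff_comp (a : Fin 4) := ((hΓ a).comp hτ hmaps).differentiableAt hT hy
  have pderiv_comp_eq (a : Fin 4) (b c : n) :
      pderiv i (fun z => Γ a (τ z) b c) y = _ :=
    congr_fun₂ (mderiv_comp hT hτ hT' hmaps (hΓ a) hy i) b c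
  ext b c
  simp only [mderiv_apply, pullbackConn, Matrix.add_apply, Matrix.sum_apply, Matrix.smul_apply,
    smul_eq_mul]
  rw [pderiv_sum _ _ fun a _ => (diff_jacobian a).fun_mul (diff_comp a b c),
    ← Finset.sum_add_distrib]
  refine Finset.sum_congr rfl fun a _ => ?_
  rw [pderiv_mul i (diff_jacobian a) (diff_comp a b c), pderiv_comp_eq a b c, Matrix.sum_apply,
    Finset.mul_sum]
  simp only [Matrix.smul_apply, smul_eq_mul, mul_assoc, mderiv_apply]

theorem curvMat_pullbackConn [Fintype n] (hΓ : ∀ a, SmoothOn (Γ a) T') (hy : y ∈ T)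
    (i j : Fin 4) :
    curvMat (pullbackConn τ Γ) i j y =
      ∑ a, ∑ b, (jacobian τ y a i * jacobian τ y b j) • curvMat Γ a b (τ y) := by
  have mul_eq (i j : Fin 4) : pullbackConn τ Γ i y * pullbackConn τ Γ j y =
      ∑ a, ∑ b, (jacobian τ y a i * jacobian τ y b j) • (Γ a (τ y) * Γ b (τ y)) := by
    simp only [pullbackConn, Finset.sum_mul_sum, Matrix.smul_mul, Matrix.mul_smul, smul_smul]
    simp only [mul_comm]
  have swap (F : Fin 4 → Fin 4 → Matrix n n ℝ) :
      ∑ a, ∑ b, (jacobian τ y a j * jacobian τ y b i) • F a b =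
        ∑ a, ∑ b, (jacobian τ y a i * jacobian τ y b j) • F b a := by
    rw [Finset.sum_comm]
    simp only [mul_comm]
  simp only [curvMat, mderiv_pullbackConn hT hτ hmaps hT' hΓ hy, mul_eq, swap,
    mderiv_jacobian_comm hT hτ hy i j, smul_add, smul_sub, Finset.sum_add_distrib,
    Finset.sum_sub_distrib]
  abel

end PullbackConnection

end Coord

/-! ### Changes of coordinates -/

namespace Coord

open scoped Matrix

/-- `τ` is a change of coordinates from `T` to `T'` which carries the almost Hermitian structure
`(G, A)` to `(G', A')`. -/
structure IsCoordChange (τ : R4 → R4) (T T' : Set R4) (G A G' A' : R4 → Matrix (Fin 4) (Fin 4) ℝ) :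
    Prop where
  left : IsHermitianOn G A T
  right : IsHermitianOn G' A' T'
  mapsTo : Set.MapsTo τ T T'
  smooth : ContDiffOn ℝ ∞ τ T
  metric : ∀ z ∈ T, G z = (jacobian τ z)ᵀ * G' (τ z) * jacobian τ z
  complex : ∀ z ∈ T, jacobian τ z * A z = A' (τ z) * jacobian τ z

namespace IsCoordChange

variable {τ : R4 → R4} {T T' : Set R4} {G A G' A' : R4 → Matrix (Fin 4) (Fin 4) ℝ} {y : R4}
  (hτ : IsCoordChange τ T T' G A G' A')
include hτ

theorem smoothOn_jacobian : SmoothOn (jacobian τ) T :=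
  Coord.smoothOn_jacobian hτ.left.isOpen hτ.smooth

theorem isUnit_det_jacobian (hy : y ∈ T) : IsUnit (jacobian τ y).det := by
  have hdet := hτ.left.det_ne_zero hy
  rw [hτ.metric y hy, Matrix.det_mul] at hdet
  exact (right_ne_zero_of_mul hdet).isUnit

theorem inv_metric (hy : y ∈ T) :
    (G' (τ y))⁻¹ = jacobian τ y * (G y)⁻¹ * (jacobian τ y)ᵀ := by
  have hu := hτ.isUnit_det_jacobian hy
  rw [hτ.metric y hy, Matrix.mul_inv_rev, Matrix.mul_inv_rev, ← Matrix.mul_assoc,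
    Matrix.mul_nonsing_inv _ hu, Matrix.one_mul,
    Matrix.nonsing_inv_mul_cancel_right _ _ (Matrix.isUnit_det_transpose _ hu)]

theorem density_eq (hy : y ∈ T) : density G y = |(jacobian τ y).det| * density G' (τ y) := by
  rw [density, density, hτ.metric y hy, Matrix.det_mul, Matrix.det_mul, Matrix.det_transpose,
    mul_right_comm, Real.sqrt_mul (mul_self_nonneg _), Real.sqrt_mul_self_eq_abs]

theorem mderiv_metric_comp (hy : y ∈ T) (i : Fin 4) :
    mderiv i (fun z => G' (τ z)) y = (pullbackConn τ (conn G') i y)ᵀ * G' (τ y)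
      + G' (τ y) * pullbackConn τ (conn G') i y := by
  rw [mderiv_comp hτ.left.isOpen hτ.smooth hτ.right.isOpen hτ.mapsTo hτ.right.smooth hy]
  simp only [pullbackConn, Matrix.transpose_sum, Matrix.transpose_smul, Finset.sum_mul,
    Finset.mul_sum, Matrix.smul_mul, Matrix.mul_smul, ← Finset.sum_add_distrib, ← smul_add,
    hτ.right.mderiv_eq_conn (hτ.mapsTo hy)]

theorem pullbackConn_mul_jacobian_comm (hy : y ∈ T) (i j l : Fin 4) :
    (pullbackConn τ (conn G') i y * jacobian τ y) l j =
      (pullbackConn τ (conn G') j y * jacobian τ y) l i := by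
  simp only [pullbackConn, Matrix.mul_apply, Matrix.sum_apply, Matrix.smul_apply, smul_eq_mul,
    Finset.sum_mul]
  rw [Finset.sum_comm]
  refine Finset.sum_congr rfl fun a _ => Finset.sum_congr rfl fun m _ => ?_
  rw [hτ.right.conn_symm (hτ.mapsTo hy) a m l]
  ring

/-- The transformation law of the Christoffel symbols. -/
theorem isParallelHom_jacobian :
    IsParallelHom (conn G) (pullbackConn τ (conn G')) (jacobian τ) T := by
  intro y hy i
  have hu := hτ.isUnit_det_jacobian hy
  have hT := hτ.left.isOpen
  have hP := hτ.smoothOn_jacobian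
  set P := jacobian τ y
  set Γ : Fin 4 → Matrix (Fin 4) (Fin 4) ℝ := fun i =>
    P⁻¹ * (pullbackConn τ (conn G') i y * P + mderiv i (jacobian τ) y) with hΓ
  have mul_Γ (i : Fin 4) : P * Γ i = pullbackConn τ (conn G') i y * P + mderiv i (jacobian τ) y :=
    Matrix.mul_nonsing_inv_cancel_left _ _ hu
  have Γ_symm (i j k : Fin 4) : Γ i k j = Γ j k i := by
    simp only [hΓ, Matrix.mul_apply (M := P⁻¹), Matrix.add_apply,
      hτ.pullbackConn_mul_jacobian_comm hy i j, mderiv_jacobian_comm hT hτ.smooth hy i j, P]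
  have Γ_metric (i : Fin 4) : mderiv i G y = (Γ i)ᵀ * G y + G y * Γ i := by
    have hG' := hτ.right.smooth.comp hτ.smooth hτ.mapsTo
    calc mderiv i G y
        = ((mderiv i (jacobian τ) y)ᵀ * G' (τ y) + Pᵀ * ((pullbackConn τ (conn G') i y)ᵀ * G' (τ y)
            + G' (τ y) * pullbackConn τ (conn G') i y)) * P
          + Pᵀ * G' (τ y) * mderiv i (jacobian τ) y := by
          rw [mderiv_congr hT hy hτ.metric, mderiv_mul hT (hP.transpose.mul hG') hP hy,
            mderiv_mul hT hP.transpose hG' hy, mderiv_transpose, hτ.mderiv_metric_comp hy]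
      _ = (P * Γ i)ᵀ * G' (τ y) * P + Pᵀ * G' (τ y) * (P * Γ i) := by
          rw [mul_Γ, Matrix.transpose_add, Matrix.transpose_mul]
          noncomm_ring
      _ = (Γ i)ᵀ * G y + G y * Γ i := by
          rw [hτ.metric y hy, Matrix.transpose_mul]
          simp only [Matrix.mul_assoc, P]
  rw [← hτ.left.conn_unique hy Γ_symm Γ_metric i, mul_Γ, add_sub_cancel_left]

theorem jacobian_mul_nablaJ (hy : y ∈ T) (i : Fin 4) :
    jacobian τ y * nablaJ G A i y =
      (∑ a, jacobian τ y a i • nablaJ G' A' a (τ y)) * jacobian τ y := by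
  have hT := hτ.left.isOpen
  rw [nablaJ, hτ.isParallelHom_jacobian.mul_covDeriv hT hτ.smoothOn_jacobian hτ.left.smooth_J
    (hτ.right.smooth_J.comp hτ.smooth hτ.mapsTo) hτ.complex hy,
    covDeriv_pullbackConn hT hτ.smooth hτ.mapsTo hτ.right.isOpen hτ.right.smooth_J hy]
  rfl

theorem jacobian_mul_curvMat (hy : y ∈ T) (i j : Fin 4) :
    jacobian τ y * curvMat (conn G) i j y =
      (∑ a, ∑ b, (jacobian τ y a i * jacobian τ y b j) • curvMat (conn G') a b (τ y))
        * jacobian τ y := by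
  have hT := hτ.left.isOpen
  rw [hτ.isParallelHom_jacobian.mul_curvMat hT hτ.left.smooth_conn hτ.smoothOn_jacobian
    (smoothOn_pullbackConn hT hτ.smooth hτ.mapsTo hτ.right.smooth_conn) hy,
    curvMat_pullbackConn hT hτ.smooth hτ.mapsTo hτ.right.isOpen hτ.right.smooth_conn hy]

theorem trace_eq_of_jacobian_mul (hy : y ∈ T) {X X' : Matrix (Fin 4) (Fin 4) ℝ}
    (h : jacobian τ y * X = X' * jacobian τ y) : X.trace = X'.trace := by
  rw [← trace_conj (Matrix.mul_nonsing_inv _ (hτ.isUnit_det_jacobian hy)) X', Matrix.mul_assoc,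
    ← h, Matrix.nonsing_inv_mul_cancel_left _ _ (hτ.isUnit_det_jacobian hy)]

theorem betaForm_eq (hy : y ∈ T) :
    betaForm G A y = (jacobian τ y)ᵀ * betaForm G' A' (τ y) * jacobian τ y := by
  ext i j
  set P := jacobian τ y
  set D : Fin 4 → Matrix (Fin 4) (Fin 4) ℝ := fun i => ∑ a, P a i • nablaJ G' A' a (τ y)
  have hN (i : Fin 4) : P * nablaJ G A i y = D i * P := hτ.jacobian_mul_nablaJ hy i
  have intertwine : P * (A y * (nablaJ G A i y * nablaJ G A j y)) =
      (A' (τ y) * (D i * D j)) * P := by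
    calc P * (A y * (nablaJ G A i y * nablaJ G A j y))
        = (P * A y) * nablaJ G A i y * nablaJ G A j y := by noncomm_ring
      _ = A' (τ y) * (P * nablaJ G A i y) * nablaJ G A j y := by
          rw [hτ.complex y hy]; noncomm_ring
      _ = A' (τ y) * D i * (P * nablaJ G A j y) := by rw [hN]; noncomm_ring
      _ = (A' (τ y) * (D i * D j)) * P := by rw [hN]; noncomm_ring
  rw [mul_mul_apply_eq_sum, betaForm, Matrix.of_apply, hτ.trace_eq_of_jacobian_mul hy intertwine,
    Finset.sum_mul_sum]
  simp only [Finset.mul_sum, Matrix.trace_sum, Matrix.smul_mul,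
    Matrix.mul_smul, Matrix.trace_smul, smul_eq_mul, betaForm, Matrix.of_apply,
    Matrix.transpose_apply]
  exact Finset.sum_congr rfl fun a _ => Finset.sum_congr rfl fun b _ => by ring

theorem rhoForm_eq (hy : y ∈ T) :
    rhoForm G A y = (jacobian τ y)ᵀ * rhoForm G' A' (τ y) * jacobian τ y := by
  ext i j
  have intertwine : jacobian τ y * (A y * curvMat (conn G) i j y) =
      (A' (τ y) * ∑ a, ∑ b, (jacobian τ y a i * jacobian τ y b j) • curvMat (conn G') a b (τ y))
        * jacobian τ y := by
    rw [← Matrix.mul_assoc, hτ.complex y hy, Matrix.mul_assoc, hτ.jacobian_mul_curvMat hy,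
      Matrix.mul_assoc]
  rw [mul_mul_apply_eq_sum, rhoForm, Matrix.of_apply, hτ.trace_eq_of_jacobian_mul hy intertwine]
  simp only [Finset.mul_sum, Matrix.trace_sum, Matrix.mul_smul, Matrix.trace_smul, smul_eq_mul,
    rhoForm, Matrix.of_apply, Matrix.transpose_apply]
  exact Finset.sum_congr rfl fun a _ => Finset.sum_congr rfl fun b _ => by ring

theorem contr_eq {β β' : R4 → Matrix (Fin 4) (Fin 4) ℝ} (hy : y ∈ T)
    (hβ : β y = (jacobian τ y)ᵀ * β' (τ y) * jacobian τ y) :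
    contr G A β y = contr G' A' β' (τ y) := by
  have bivec_eq : bivec G' A' (τ y) = jacobian τ y * bivec G A y * (jacobian τ y)ᵀ := by
    rw [bivec, hτ.inv_metric hy, ← Matrix.mul_assoc, ← Matrix.mul_assoc, ← hτ.complex y hy, bivec,
      ← Matrix.mul_assoc]
  rw [contr, contr, hβ, bivec_eq, Matrix.transpose_mul, Matrix.transpose_mul,
    Matrix.transpose_transpose, Matrix.mul_assoc, Matrix.mul_assoc, Matrix.trace_mul_comm]
  simp only [Matrix.mul_assoc]

theorem leeVec_eq (hy : y ∈ T) : leeVec G' A' (τ y) = jacobian τ y *ᵥ leeVec G A y := by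
  set P := jacobian τ y
  have jacobian_mul_jNablaJ (i : Fin 4) : P * jNablaJ G A i y =
      (∑ a, P a i • jNablaJ G' A' a (τ y)) * P := by
    rw [jNablaJ, ← Matrix.mul_assoc, hτ.complex y hy, Matrix.mul_assoc,
      hτ.jacobian_mul_nablaJ hy, ← Matrix.mul_assoc, Finset.mul_sum]
    simp only [Matrix.mul_smul, jNablaJ, P]
  ext b
  calc leeVec G' A' (τ y) b
      = -∑ a, (jNablaJ G' A' a (τ y) * P * (G y)⁻¹ * Pᵀ) b a := by
        rw [hτ.right.leeVec_eq_neg (hτ.mapsTo hy), hτ.inv_metric hy]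
        simp only [Matrix.mul_assoc, P]
    _ = -∑ i, ((∑ a, P a i • jNablaJ G' A' a (τ y)) * P * (G y)⁻¹) b i := by
        simp only [Matrix.mul_apply (N := Pᵀ), Finset.sum_mul, Matrix.sum_apply, Matrix.smul_mul,
          Matrix.smul_apply, smul_eq_mul, Matrix.transpose_apply]
        rw [Finset.sum_comm]
        simp only [mul_comm]
    _ = -∑ i, (P * (jNablaJ G A i y * (G y)⁻¹)) b i := by
        simp only [← jacobian_mul_jNablaJ, Matrix.mul_assoc]
    _ = (P *ᵥ leeVec G A y) b := by
        simp only [Matrix.mulVec, dotProduct, hτ.left.leeVec_eq_neg hy, Matrix.mul_apply (M := P),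
          mul_neg, Finset.mul_sum, Finset.sum_neg_distrib]
        rw [Finset.sum_comm]

theorem dirDeriv_leeVec_eq {f' : R4 → ℝ} (hf' : DifferentiableAt ℝ f' (τ y)) (hy : y ∈ T) :
    dirDeriv (leeVec G A y) (fun z => f' (τ z)) y = dirDeriv (leeVec G' A' (τ y)) f' (τ y) := by
  have hτy : DifferentiableAt ℝ τ y :=
    (hτ.smooth.contDiffAt (hτ.left.isOpen.mem_nhds hy)).differentiableAt (by simp)
  simp only [dirDeriv, pderiv_comp hτy hf', hτ.leeVec_eq hy, Matrix.mulVec, dotProduct,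
    Finset.mul_sum, Finset.sum_mul]
  rw [Finset.sum_comm]
  exact Finset.sum_congr rfl fun a _ => Finset.sum_congr rfl fun k _ => by ring

end IsCoordChange

end Coord

/-! ### Components in the charts of a manifold -/

namespace AlmostHermitian

open Coord
open scoped Matrix

variable {M : Type*} [TopologicalSpace M] [ChartedSpace R4 M]

/-- The differential of the inverse of a chart, with the tangent space identified with `ℝ⁴`. -/
def symmDeriv (e : OpenPartialHomeomorph M R4) (y : R4) : R4 →L[ℝ] R4 :=
  mfderiv 𝓘(ℝ, R4) 𝓘(ℝ, R4) e.symm y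

/-- The differential of a chart, with the tangent space identified with `ℝ⁴`. -/
def chartDeriv (e : OpenPartialHomeomorph M R4) (x : M) : R4 →L[ℝ] R4 :=
  mfderiv 𝓘(ℝ, R4) 𝓘(ℝ, R4) e x

variable [IsManifold 𝓘(ℝ, R4) ∞ M] {e e' : OpenPartialHomeomorph M R4} {y : R4}

theorem chartDeriv_comp_symmDeriv (he : e ∈ atlas R4 M) (hy : y ∈ e.target) :
    chartDeriv e (e.symm y) ∘L symmDeriv e y = .id ℝ R4 :=
  (mdifferentiable_of_mem_atlas (I := 𝓘(ℝ, R4)) he).comp_symm_deriv hy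

theorem symmDeriv_comp_chartDeriv (he : e ∈ atlas R4 M) (hy : y ∈ e.target) :
    symmDeriv e y ∘L chartDeriv e (e.symm y) = .id ℝ R4 := by
  have comp_eq := (mdifferentiable_of_mem_atlas (I := 𝓘(ℝ, R4)) he).symm_comp_deriv
    (e.map_target hy)
  rwa [e.right_inv hy] at comp_eq

/-- The metric, with the tangent space identified with `ℝ⁴`. -/
def innerR4 (S : AlmostHermitian M) (x : M) : R4 →L[ℝ] R4 →L[ℝ] ℝ := S.g.inner x

/-- The almost complex structure, with the tangent space identified with `ℝ⁴`. -/
def complexR4 (S : AlmostHermitian M) (x : M) : R4 →L[ℝ] R4 := S.J x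

/-- The metric in the chart `e`, as a bilinear form on `ℝ⁴`. -/
def chartMetric (S : AlmostHermitian M) (e : OpenPartialHomeomorph M R4) (y : R4) :
    R4 →ₗ[ℝ] R4 →ₗ[ℝ] ℝ :=
  (S.innerR4 (e.symm y)).toLinearMap₁₂.compl₁₂ (symmDeriv e y).toLinearMap
    (symmDeriv e y).toLinearMap

/-- The almost complex structure in the chart `e`, as an endomorphism of `ℝ⁴`. -/
def chartComplex (S : AlmostHermitian M) (e : OpenPartialHomeomorph M R4) (y : R4) :
    R4 →L[ℝ] R4 :=
  chartDeriv e (e.symm y) ∘L S.complexR4 (e.symm y) ∘L symmDeriv e y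

theorem symmDeriv_chartComplex (S : AlmostHermitian M) (he : e ∈ atlas R4 M) (hy : y ∈ e.target)
    (v : R4) : symmDeriv e y (S.chartComplex e y v) = S.complexR4 (e.symm y) (symmDeriv e y v) :=
  DFunLike.congr_fun (symmDeriv_comp_chartDeriv he hy) _

theorem chartComplex_chartComplex (S : AlmostHermitian M) (he : e ∈ atlas R4 M)
    (hy : y ∈ e.target) (v : R4) : S.chartComplex e y (S.chartComplex e y v) = -v := by
  have J_sq (w : R4) : S.complexR4 (e.symm y) (S.complexR4 (e.symm y) w) = -w :=
    S.J_sq (e.symm y) w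
  rw [chartComplex, ContinuousLinearMap.comp_apply, ContinuousLinearMap.comp_apply,
    ← chartComplex, S.symmDeriv_chartComplex he hy, J_sq, map_neg]
  exact congrArg Neg.neg (DFunLike.congr_fun (chartDeriv_comp_symmDeriv he hy) v)

theorem chartMetric_compl₁₂_chartComplex (S : AlmostHermitian M) (he : e ∈ atlas R4 M)
    (hy : y ∈ e.target) :
    (S.chartMetric e y).compl₁₂ (S.chartComplex e y).toLinearMap (S.chartComplex e y).toLinearMap =
      S.chartMetric e y := by
  refine LinearMap.ext₂ fun v w => ?_
  change S.innerR4 _ (symmDeriv e y (S.chartComplex e y v))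
    (symmDeriv e y (S.chartComplex e y w)) = _
  rw [S.symmDeriv_chartComplex he hy, S.symmDeriv_chartComplex he hy]
  exact S.J_orthogonal _ _ _

/-- The matrix of an endomorphism of `ℝ⁴` in the standard basis. -/
def stdMatrix (L : R4 →L[ℝ] R4) : Matrix (Fin 4) (Fin 4) ℝ :=
  LinearMap.toMatrix (EuclideanSpace.basisFun (Fin 4) ℝ).toBasis
    (EuclideanSpace.basisFun (Fin 4) ℝ).toBasis L.toLinearMap

/-- The matrix of a bilinear form on `ℝ⁴` in the standard basis. -/
def stdMatrix₂ (B : R4 →ₗ[ℝ] R4 →ₗ[ℝ] ℝ) : Matrix (Fin 4) (Fin 4) ℝ :=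
  LinearMap.toMatrix₂ (EuclideanSpace.basisFun (Fin 4) ℝ).toBasis
    (EuclideanSpace.basisFun (Fin 4) ℝ).toBasis B

theorem stdMatrix_comp (K L : R4 →L[ℝ] R4) : stdMatrix (K ∘L L) = stdMatrix K * stdMatrix L :=
  LinearMap.toMatrix_comp _ _ _ _ _

theorem stdMatrix₂_compl₁₂ (B : R4 →ₗ[ℝ] R4 →ₗ[ℝ] ℝ) (L : R4 →L[ℝ] R4) :
    stdMatrix₂ (B.compl₁₂ L.toLinearMap L.toLinearMap) =
      (stdMatrix L)ᵀ * stdMatrix₂ B * stdMatrix L :=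
  LinearMap.toMatrix₂_compl₁₂ _ _ _ _ _ _ _

theorem stdMatrix_fderiv {τ : R4 → R4} (hτ : DifferentiableAt ℝ τ y) :
    stdMatrix (fderiv ℝ τ y) = jacobian τ y := by
  ext a i
  rw [← fderiv_single_apply hτ, stdMatrix, LinearMap.toMatrix_apply,
    OrthonormalBasis.coe_toBasis, EuclideanSpace.basisFun_apply]
  rfl

theorem metricMatrix_eq_stdMatrix₂ (S : AlmostHermitian M) :
    S.metricMatrix e y = stdMatrix₂ (S.chartMetric e y) := by
  ext i j
  rw [stdMatrix₂, LinearMap.toMatrix₂_apply, OrthonormalBasis.coe_toBasis,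
    EuclideanSpace.basisFun_apply, EuclideanSpace.basisFun_apply]
  rfl

theorem complexMatrix_eq_stdMatrix (S : AlmostHermitian M) :
    S.complexMatrix e y = stdMatrix (S.chartComplex e y) := by
  ext i j
  rw [stdMatrix, LinearMap.toMatrix_apply, OrthonormalBasis.coe_toBasis,
    EuclideanSpace.basisFun_apply]
  rfl

theorem mem_maximalAtlas (he : e ∈ atlas R4 M) : e ∈ IsManifold.maximalAtlas 𝓘(ℝ, R4) ∞ M :=
  StructureGroupoid.subset_maximalAtlas _ he

theorem contMDiffOn_coordVector (he : e ∈ atlas R4 M) (j : Fin 4) :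
    ContMDiffOn 𝓘(ℝ, R4) 𝓘(ℝ, R4).tangent ∞
      (fun y => (⟨e.symm y, coordVector e y j⟩ : TangentBundle 𝓘(ℝ, R4) M)) e.target := by
  have : IsManifold 𝓘(ℝ, R4) 1 M := IsManifold.of_le (n := ∞) (by simp)
  have smooth_tangentMap := (contMDiffOn_symm_of_mem_maximalAtlas
    (mem_maximalAtlas he)).contMDiffOn_tangentMapWithin (m := ∞) (by simp)
      e.open_target.uniqueMDiffOn
  have smooth_single : ContMDiff 𝓘(ℝ, R4) 𝓘(ℝ, R4).tangent ∞
      (fun y : R4 => (⟨y, (EuclideanSpace.single j (1 : ℝ) : R4)⟩ : TangentBundle 𝓘(ℝ, R4) R4)) :=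
    fun y => contMDiffAt_vectorSpace_iff_contDiffAt.2 contDiffAt_const
  refine (smooth_tangentMap.comp smooth_single.contMDiffOn fun y hy => hy).congr fun y hy => ?_
  simp only [tangentMapWithin, Function.comp, mfderivWithin_of_isOpen e.open_target hy]
  rfl

theorem smoothOn_metricMatrix (S : AlmostHermitian M) (he : e ∈ atlas R4 M) :
    SmoothOn (S.metricMatrix e) e.target := by
  intro i j
  have smooth_inner : ContMDiffOn 𝓘(ℝ, R4) (𝓘(ℝ, R4).prod 𝓘(ℝ)) ∞
      (fun y => Bundle.TotalSpace.mk' ℝ (E := Bundle.Trivial M ℝ) (e.symm y)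
        (S.g.inner (e.symm y) (coordVector e y i) (coordVector e y j))) e.target := by
    apply ContMDiffOn.clm_bundle_apply₂ (F₁ := R4) (F₂ := R4)
    · exact S.g.contMDiff.comp_contMDiffOn
        (contMDiffOn_symm_of_mem_maximalAtlas (mem_maximalAtlas he))
    · exact contMDiffOn_coordVector he i
    · exact contMDiffOn_coordVector he j
  rw [← contMDiffOn_iff_contDiffOn]
  exact fun y hy => (Bundle.contMDiffWithinAt_totalSpace.1 (smooth_inner y hy)).2

theorem smoothOn_complexMatrix (S : AlmostHermitian M) (he : e ∈ atlas R4 M) :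
    SmoothOn (S.complexMatrix e) e.target := by
  intro i j
  have : IsManifold 𝓘(ℝ, R4) 1 M := IsManifold.of_le (n := ∞) (by simp)
  have smooth_J_coord : ContMDiffOn 𝓘(ℝ, R4) 𝓘(ℝ, R4).tangent ∞
      (fun y => (⟨e.symm y, S.J (e.symm y) (coordVector e y j)⟩ : TangentBundle 𝓘(ℝ, R4) M))
      e.target := by
    apply ContMDiffOn.clm_bundle_apply (F₁ := R4) (F₂ := R4)
    · exact S.smooth_J.comp_contMDiffOn
        (contMDiffOn_symm_of_mem_maximalAtlas (mem_maximalAtlas he))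
    · exact contMDiffOn_coordVector he j
  have smooth_tangentMap := (contMDiffOn_of_mem_maximalAtlas
    (mem_maximalAtlas he)).contMDiffOn_tangentMapWithin (m := ∞) (by simp)
      e.open_source.uniqueMDiffOn
  have smooth_chartDeriv := contMDiffOn_iff_contDiffOn.1
    ((contMDiff_snd_tangentBundle_modelSpace R4 𝓘(ℝ, R4)).comp_contMDiffOn
      (smooth_tangentMap.comp smooth_J_coord fun y hy => e.map_target hy))
  refine ((EuclideanSpace.proj (𝕜 := ℝ) i).contDiff.comp_contDiffOn
    smooth_chartDeriv).congr fun y hy => ?_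
  simp only [tangentMapWithin, Function.comp,
    mfderivWithin_of_isOpen e.open_source (e.map_target hy)]
  rfl

theorem posDef_metricMatrix (S : AlmostHermitian M) (he : e ∈ atlas R4 M) (hy : y ∈ e.target) :
    (S.metricMatrix e y).PosDef := by
  refine Matrix.PosDef.of_dotProduct_mulVec_pos ?_ fun v hv => ?_
  · ext i j
    exact S.g.symm _ _ _
  · let w := (EuclideanSpace.basisFun (Fin 4) ℝ).toBasis.equivFun.symm v
    have hw : symmDeriv e y w ≠ 0 := by
      intro hzero
      refine hv ((LinearEquiv.map_eq_zero_iff _).1 (?_ : w = 0))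
      have := DFunLike.congr_fun (chartDeriv_comp_symmDeriv he hy) w
      rwa [ContinuousLinearMap.comp_apply, hzero, map_zero, eq_comm] at this
    rw [S.metricMatrix_eq_stdMatrix₂, stdMatrix₂, star_trivial]
    exact (S.g.pos (e.symm y) (symmDeriv e y w) hw).trans_eq
      (dotProduct_toMatrix₂_mulVec _ _ (S.chartMetric e y) v v).symm

theorem isHermitianOn (S : AlmostHermitian M) (he : e ∈ atlas R4 M) :
    IsHermitianOn (S.metricMatrix e) (S.complexMatrix e) e.target where
  isOpen := e.open_target
  smooth := S.smoothOn_metricMatrix he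
  posDef _ hy := S.posDef_metricMatrix he hy
  smooth_J := S.smoothOn_complexMatrix he
  sq y hy := by
    have comp_self : S.chartComplex e y ∘L S.chartComplex e y = -.id ℝ R4 :=
      ContinuousLinearMap.ext (S.chartComplex_chartComplex he hy)
    rw [S.complexMatrix_eq_stdMatrix, ← stdMatrix_comp, comp_self, stdMatrix,
      ContinuousLinearMap.toLinearMap_neg, map_neg, ContinuousLinearMap.coe_id,
      LinearMap.toMatrix_id]
  orthogonal y hy := by
    rw [S.complexMatrix_eq_stdMatrix, S.metricMatrix_eq_stdMatrix₂, ← stdMatrix₂_compl₁₂,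
      S.chartMetric_compl₁₂_chartComplex he hy]

/-- The change of coordinates between two charts. -/
def transition (e e' : OpenPartialHomeomorph M R4) (y : R4) : R4 := e' (e.symm y)

/-- The points of `ℝ⁴` which are coordinates in the chart `e` of points of the chart `e'`. -/
def overlap (e e' : OpenPartialHomeomorph M R4) : Set R4 := e.target ∩ e.symm ⁻¹' e'.source

omit [ChartedSpace R4 M] [IsManifold 𝓘(ℝ, R4) ∞ M] in
theorem isOpen_overlap (e e' : OpenPartialHomeomorph M R4) : IsOpen (overlap e e') :=
  e.symm.isOpen_inter_preimage e'.open_source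

theorem contDiffOn_transition (he : e ∈ atlas R4 M) (he' : e' ∈ atlas R4 M) :
    ContDiffOn ℝ ∞ (transition e e') (overlap e e') := by
  rw [← contMDiffOn_iff_contDiffOn]
  exact (contMDiffOn_of_mem_maximalAtlas (mem_maximalAtlas he')).comp
    ((contMDiffOn_symm_of_mem_maximalAtlas (mem_maximalAtlas he)).mono Set.inter_subset_left)
    fun y hy => hy.2

theorem differentiableAt_transition (he : e ∈ atlas R4 M) (he' : e' ∈ atlas R4 M)
    (hy : y ∈ overlap e e') : DifferentiableAt ℝ (transition e e') y :=
  ((contDiffOn_transition he he').contDiffAt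
    ((isOpen_overlap e e').mem_nhds hy)).differentiableAt (by simp)

theorem symmDeriv_comp_fderiv_transition (he : e ∈ atlas R4 M) (he' : e' ∈ atlas R4 M)
    (hy : y ∈ overlap e e') :
    symmDeriv e' (transition e e' y) ∘L fderiv ℝ (transition e e') y = symmDeriv e y := by
  have symm_eventuallyEq : e'.symm ∘ transition e e' =ᶠ[nhds y] e.symm := by
    filter_upwards [(isOpen_overlap e e').mem_nhds hy] with z hz using e'.left_inv hz.2
  have chain := mfderiv_comp y (I := 𝓘(ℝ, R4)) (I' := 𝓘(ℝ, R4)) (I'' := 𝓘(ℝ, R4)) (g := e'.symm)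
    (f := transition e e') (mdifferentiableAt_atlas_symm he' (e'.map_source hy.2))
    (differentiableAt_transition he he' hy).mdifferentiableAt
  rw [mfderiv_eq_fderiv, symm_eventuallyEq.mfderiv_eq] at chain
  exact chain.symm

theorem chartMetric_transition (S : AlmostHermitian M) (he : e ∈ atlas R4 M)
    (he' : e' ∈ atlas R4 M) (hy : y ∈ overlap e e') :
    S.chartMetric e y = (S.chartMetric e' (transition e e' y)).compl₁₂
      (fderiv ℝ (transition e e') y).toLinearMap (fderiv ℝ (transition e e') y).toLinearMap := by
  rw [chartMetric, ← symmDeriv_comp_fderiv_transition he he' hy, chartMetric, transition,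
    e'.left_inv hy.2]
  rfl

theorem fderiv_transition_comp_chartComplex (S : AlmostHermitian M) (he : e ∈ atlas R4 M)
    (he' : e' ∈ atlas R4 M) (hy : y ∈ overlap e e') :
    fderiv ℝ (transition e e') y ∘L S.chartComplex e y =
      S.chartComplex e' (transition e e' y) ∘L fderiv ℝ (transition e e') y := by
  have hy' : transition e e' y ∈ e'.target := e'.map_source hy.2
  have symmDeriv_eq := symmDeriv_comp_fderiv_transition he he' hy
  set D := fderiv ℝ (transition e e') y
  have base_eq : e'.symm (transition e e' y) = e.symm y := e'.left_inv hy.2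
  calc D ∘L S.chartComplex e y
      = (chartDeriv e' (e'.symm (transition e e' y)) ∘L symmDeriv e' (transition e e' y)) ∘L
          (D ∘L S.chartComplex e y) := by
        rw [chartDeriv_comp_symmDeriv he' hy', ContinuousLinearMap.id_comp]
    _ = chartDeriv e' (e.symm y) ∘L symmDeriv e y ∘L S.chartComplex e y := by
        rw [← symmDeriv_eq, base_eq]
        rfl
    _ = chartDeriv e' (e.symm y) ∘L S.complexR4 (e.symm y) ∘L symmDeriv e y := by
        congr 1
        exact ContinuousLinearMap.ext (S.symmDeriv_chartComplex he hy.1)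
    _ = S.chartComplex e' (transition e e' y) ∘L D := by
        rw [← symmDeriv_eq, chartComplex, base_eq]
        rfl

theorem isCoordChange (S : AlmostHermitian M) (he : e ∈ atlas R4 M) (he' : e' ∈ atlas R4 M) :
    IsCoordChange (transition e e') (overlap e e') e'.target
      (S.metricMatrix e) (S.complexMatrix e) (S.metricMatrix e') (S.complexMatrix e') where
  left := (S.isHermitianOn he).mono (isOpen_overlap e e') Set.inter_subset_left
  right := S.isHermitianOn he'
  mapsTo _ hy := e'.map_source hy.2
  smooth := contDiffOn_transition he he'
  metric y hy := by
    rw [S.metricMatrix_eq_stdMatrix₂, S.metricMatrix_eq_stdMatrix₂,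
      ← stdMatrix_fderiv (differentiableAt_transition he he' hy), ← stdMatrix₂_compl₁₂,
      S.chartMetric_transition he he' hy]
  complex y hy := by
    rw [S.complexMatrix_eq_stdMatrix, S.complexMatrix_eq_stdMatrix,
      ← stdMatrix_fderiv (differentiableAt_transition he he' hy), ← stdMatrix_comp,
      ← stdMatrix_comp, S.fderiv_transition_comp_chartComplex he he' hy]

end AlmostHermitian

/-! ### Integration over the manifold -/

namespace Coord

open MeasureTheory

variable {T : Set R4} {f q r : R4 → ℝ} {y : R4}

theorem contDiff_indicator {n : WithTop ℕ∞} (hT : IsOpen T) (hf : ContDiffOn ℝ n f T)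
    (hsub : tsupport (T.indicator f) ⊆ T) : ContDiff ℝ n (T.indicator f) := by
  refine contDiff_iff_contDiffAt.2 fun y => ?_
  by_cases hy : y ∈ T
  · exact (hf.contDiffAt (hT.mem_nhds hy)).congr_of_eventuallyEq
      ((Set.eqOn_indicator (f := f)).eventuallyEq_of_mem (hT.mem_nhds hy))
  · exact contDiffAt_const.congr_of_eventuallyEq
      (notMem_tsupport_iff_eventuallyEq.1 fun h => hy (hsub h))

theorem integral_pderiv_eq_zero (hf : ContDiff ℝ ∞ f) (hc : HasCompactSupport f) (i : Fin 4) :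
    ∫ y, pderiv i f y = 0 := by
  have integrable_pderiv : Integrable (pderiv i f) :=
    ((hf.continuous_fderiv (by simp)).clm_apply continuous_const).integrable_of_hasCompactSupport
      (hc.fderiv_apply ℝ _)
  have by_parts := integral_mul_fderiv_eq_neg_fderiv_mul_of_integrable (μ := (volume : Measure R4))
    (f := fun _ => (1 : ℝ)) (g := f) (v := EuclideanSpace.single i (1 : ℝ)) (by simp)
    (by simp only [one_mul]; exact integrable_pderiv)
    (by simpa only [one_mul] using hf.continuous.integrable_of_hasCompactSupport hc) (by simp)
    (fun x _ => hf.differentiable (by simp) x)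
  simpa [pderiv] using by_parts

theorem setIntegral_sum_pderiv_eq_zero {F : Fin 4 → R4 → ℝ} (hT : IsOpen T)
    (hF : ∀ k, ContDiffOn ℝ ∞ (F k) T) (hc : ∀ k, HasCompactSupport (T.indicator (F k)))
    (hsub : ∀ k, tsupport (T.indicator (F k)) ⊆ T) : ∫ y in T, ∑ k, pderiv k (F k) y = 0 := by
  have smooth (k : Fin 4) := contDiff_indicator hT (hF k) (hsub k)
  have integrable_pderiv (k : Fin 4) : Integrable (pderiv k (T.indicator (F k))) :=
    (((smooth k).continuous_fderiv (by simp)).clm_apply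
      continuous_const).integrable_of_hasCompactSupport ((hc k).fderiv_apply ℝ _)
  have pderiv_eq_zero (k : Fin 4) (y : R4) (hy : y ∉ T) : pderiv k (T.indicator (F k)) y = 0 := by
    rw [pderiv, fderiv_of_notMem_tsupport ℝ fun h => hy (hsub k h), zero_apply]
  calc ∫ y in T, ∑ k, pderiv k (F k) y
      = ∫ y in T, ∑ k, pderiv k (T.indicator (F k)) y :=
        setIntegral_congr_fun hT.measurableSet fun y hy => Finset.sum_congr rfl fun k _ =>
          pderiv_congr hT hy Set.eqOn_indicator.symm
    _ = ∫ y, ∑ k, pderiv k (T.indicator (F k)) y :=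
        setIntegral_eq_integral_of_forall_compl_eq_zero fun y hy =>
          Finset.sum_eq_zero fun k _ => pderiv_eq_zero k y hy
    _ = 0 := by
        rw [integral_finsetSum _ fun k _ => integrable_pderiv k]
        exact Finset.sum_eq_zero fun k _ => integral_pderiv_eq_zero (smooth k) (hc k) k

theorem smooth_dirDeriv {v : R4 → Fin 4 → ℝ} (hT : IsOpen T)
    (hv : ∀ k, ContDiffOn ℝ ∞ (fun z => v z k) T) (hf : ContDiffOn ℝ ∞ f T) :
    ContDiffOn ℝ ∞ (fun z => dirDeriv (v z) f z) T :=
  ContDiffOn.sum fun k _ => (hv k).mul (contDiffOn_pderiv hT hf k)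

theorem dirDeriv_congr {h : R4 → ℝ} {v : Fin 4 → ℝ} (hT : IsOpen T) (hy : y ∈ T)
    (hfh : Set.EqOn f h T) : dirDeriv v f y = dirDeriv v h y :=
  Finset.sum_congr rfl fun _ _ => congrArg _ (pderiv_congr hT hy hfh)

theorem dirDeriv_const (v : Fin 4 → ℝ) (c : ℝ) : dirDeriv v (fun _ => c) y = 0 := by
  simp only [dirDeriv, pderiv_const, mul_zero, Finset.sum_const_zero]

theorem dirDeriv_sum {ι : Type*} (s : Finset ι) (v : Fin 4 → ℝ) {u : ι → R4 → ℝ}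
    (hu : ∀ j ∈ s, DifferentiableAt ℝ (u j) y) :
    dirDeriv v (fun z => ∑ j ∈ s, u j z) y = ∑ j ∈ s, dirDeriv v (u j) y := by
  simp only [dirDeriv, pderiv_sum s _ hu, Finset.mul_sum]
  exact Finset.sum_comm

theorem pderiv_div_abs (hq : DifferentiableAt ℝ q y) (hr : DifferentiableAt ℝ r y) (hr0 : r y ≠ 0)
    (i : Fin 4) : pderiv i (fun z => q z / |r z|) y =
      (r y * pderiv i q y - q y * pderiv i r y) / (r y * |r y|) := by
  have abs_ne_zero : |r y| ≠ 0 := abs_ne_zero.2 hr0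
  have inv_abs_deriv := ((hasDerivAt_abs hr0).fun_inv abs_ne_zero).comp_hasFDerivAt y hr.hasFDerivAt
  have quotient_deriv : HasFDerivAt (fun z => q z / |r z|) _ y := hq.hasFDerivAt.mul inv_abs_deriv
  rw [pderiv, quotient_deriv.fderiv]
  simp only [pderiv, add_apply, smul_apply, smul_eq_mul]
  have sign_mul : (SignType.sign (r y) : ℝ) * |r y| = r y := sign_mul_abs (r y)
  rw [sq_abs]
  field_simp
  linear_combination (-(q y * fderiv ℝ r y (EuclideanSpace.single i 1))) * sign_mul

theorem dirDeriv_div_abs_eq_zero {v : Fin 4 → ℝ} (hq : DifferentiableAt ℝ q y)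
    (hr : DifferentiableAt ℝ r y) (hr0 : r y ≠ 0)
    (h : r y * dirDeriv v q y = q y * dirDeriv v r y) :
    dirDeriv v (fun z => q z / |r z|) y = 0 := by
  have sum_eq : dirDeriv v (fun z => q z / |r z|) y =
      (r y * dirDeriv v q y - q y * dirDeriv v r y) / (r y * |r y|) := by
    simp only [dirDeriv, pderiv_div_abs hq hr hr0, Finset.mul_sum, ← Finset.sum_sub_distrib,
      Finset.sum_div]
    exact Finset.sum_congr rfl fun _ _ => by ring
  rw [sum_eq, h, sub_self, zero_div]

theorem IsHermitianOn.sum_pderiv_mul_density_mul_leeVec {G A : R4 → Matrix (Fin 4) (Fin 4) ℝ}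
    (hH : IsHermitianOn G A T) (hf : ContDiffOn ℝ ∞ f T) (hy : y ∈ T) :
    ∑ k, pderiv k (fun z => f z * (density G z * leeVec G A z k)) y =
      (dirDeriv (leeVec G A y) f y - f y * codiffOne G (leeForm G A) y) * density G y := by
  have diff_f := differentiableAt_of_contDiffOn hH.isOpen hf hy
  have diff_lee (k : Fin 4) := differentiableAt_of_contDiffOn hH.isOpen
    (hH.smooth_density.mul (hH.smooth_leeVec k)) hy
  have divergence : ∑ k, pderiv k (fun z => density G z * leeVec G A z k) y = _ :=
    hH.sum_pderiv_density_mul hH.smooth_leeForm hy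
  simp only [pderiv_mul _ diff_f (diff_lee _), Finset.sum_add_distrib, ← Finset.mul_sum,
    divergence, dirDeriv, sub_mul, Finset.sum_mul]
  rw [mul_neg, ← sub_eq_add_neg, mul_assoc, mul_comm (codiffOne _ _ _)]
  exact congrArg (· - _) (Finset.sum_congr rfl fun _ _ => by ring)

end Coord

namespace AlmostHermitian

open Coord MeasureTheory

section ChartSupport

variable {M : Type*} [TopologicalSpace M] {e e' : OpenPartialHomeomorph M R4} {x : M} {h : M → ℝ}

theorem mem_overlap (hx : x ∈ e.source) (hx' : x ∈ e'.source) : e x ∈ overlap e e' :=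
  ⟨e.map_source hx, by rwa [Set.mem_preimage, e.left_inv hx]⟩

theorem image_transition_overlap (e e' : OpenPartialHomeomorph M R4) :
    transition e e' '' overlap e e' = overlap e' e := by
  ext z
  constructor
  · rintro ⟨y, hy, rfl⟩
    exact mem_overlap hy.2 (e.map_target hy.1)
  · rintro ⟨hz, hz'⟩
    exact ⟨e (e'.symm z), mem_overlap hz' (e'.map_target hz), by
      rw [transition, e.left_inv hz', e'.right_inv hz]⟩

theorem injOn_transition (e e' : OpenPartialHomeomorph M R4) :
    Set.InjOn (transition e e') (overlap e e') := fun _ hy _ hz hyz =>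
  e.symm.injOn hy.1 hz.1 (e'.injOn hy.2 hz.2 hyz)

variable [CompactSpace M]

theorem isCompact_image_tsupport (hh : tsupport h ⊆ e.source) : IsCompact (e '' tsupport h) :=
  (isClosed_tsupport h).isCompact.image_of_continuousOn (e.continuousOn.mono hh)

theorem tsupport_indicator_subset_image (hh : tsupport h ⊆ e.source) (d : R4 → ℝ) :
    tsupport (e.target.indicator fun y => h (e.symm y) * d y) ⊆ e '' tsupport h := by
  refine closure_minimal (fun y hy => ?_) (isCompact_image_tsupport hh).isClosed
  obtain ⟨hy, hne⟩ := Set.indicator_apply_ne_zero.1 hy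
  exact ⟨e.symm y, subset_tsupport h (left_ne_zero_of_mul hne), e.right_inv hy⟩

theorem tsupport_indicator_subset_target (hh : tsupport h ⊆ e.source) (d : R4 → ℝ) :
    tsupport (e.target.indicator fun y => h (e.symm y) * d y) ⊆ e.target := by
  refine (tsupport_indicator_subset_image hh d).trans ?_
  rintro _ ⟨x, hx, rfl⟩
  exact e.map_source (hh hx)

theorem hasCompactSupport_indicator (hh : tsupport h ⊆ e.source) (d : R4 → ℝ) :
    HasCompactSupport (e.target.indicator fun y => h (e.symm y) * d y) :=
  (isCompact_image_tsupport hh).of_isClosed_subset (isClosed_tsupport _)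
    (tsupport_indicator_subset_image hh d)

end ChartSupport

variable {M : Type*} [TopologicalSpace M] [ChartedSpace R4 M]

section Gluing

/-- Functions given in the charts of the atlas that agree under coordinate changes, so that they
are the coordinate expressions of one function on the manifold. -/
def ChartCompatible (F : OpenPartialHomeomorph M R4 → R4 → ℝ) : Prop :=
  ∀ e ∈ atlas R4 M, ∀ e' ∈ atlas R4 M, ∀ y ∈ overlap e e', F e y = F e' (transition e e' y)

/-- The function on the manifold with given coordinate expressions, read off at `x` in the
preferred chart at `x`. -/
def glue (F : OpenPartialHomeomorph M R4 → R4 → ℝ) (x : M) : ℝ :=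
  F (chartAt R4 x) (chartAt R4 x x)

namespace ChartCompatible

variable {F : OpenPartialHomeomorph M R4 → R4 → ℝ} {e : OpenPartialHomeomorph M R4}

theorem glue_eq (hF : ChartCompatible F) (he : e ∈ atlas R4 M) {x : M} (hx : x ∈ e.source) :
    glue F x = F e (e x) := by
  have compat := hF e he _ (chart_mem_atlas R4 x) (e x) (mem_overlap hx (mem_chart_source R4 x))
  rw [transition, e.left_inv hx] at compat
  exact compat.symm

theorem glue_symm (hF : ChartCompatible F) (he : e ∈ atlas R4 M) {y : R4} (hy : y ∈ e.target) :
    glue F (e.symm y) = F e y := by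
  rw [hF.glue_eq he (e.map_target hy), e.right_inv hy]

theorem contMDiff_glue [IsManifold 𝓘(ℝ, R4) ∞ M] (hF : ChartCompatible F)
    (hsmooth : ∀ e ∈ atlas R4 M, ContDiffOn ℝ ∞ (F e) e.target) :
    ContMDiff 𝓘(ℝ, R4) 𝓘(ℝ) ∞ (glue F) := by
  intro x
  have hx := mem_chart_source R4 x
  have he := chart_mem_atlas R4 x
  have smooth_coord := ((hsmooth _ he).contDiffAt
    ((chartAt R4 x).open_target.mem_nhds ((chartAt R4 x).map_source hx))).contMDiffAt
  refine (smooth_coord.comp x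
    (contMDiffAt_of_mem_maximalAtlas (mem_maximalAtlas he) hx)).congr_of_eventuallyEq ?_
  filter_upwards [(chartAt R4 x).open_source.mem_nhds hx] with z hz using hF.glue_eq he hz

end ChartCompatible

end Gluing

variable [IsManifold 𝓘(ℝ, R4) ∞ M] {e e' : OpenPartialHomeomorph M R4} {h v : M → ℝ}
  {S : AlmostHermitian M}

/-- The integral of a function over a chart domain, against the Riemannian volume. -/
def chartIntegral (S : AlmostHermitian M) (e : OpenPartialHomeomorph M R4) (h : M → ℝ) : ℝ :=
  ∫ y in e.target, h (e.symm y) * density (S.metricMatrix e) y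

theorem continuous_indicator_mul_density [CompactSpace M] (S : AlmostHermitian M)
    (he : e ∈ atlas R4 M) (hc : Continuous h) (hh : tsupport h ⊆ e.source) :
    Continuous (e.target.indicator fun y => h (e.symm y) * density (S.metricMatrix e) y) := by
  refine contDiff_zero.1 (contDiff_indicator e.open_target (contDiffOn_zero.2 ?_)
    (tsupport_indicator_subset_target hh _))
  exact (hc.comp_continuousOn e.continuousOn_symm).mul
    (S.isHermitianOn he).smooth_density.continuousOn

theorem integrableOn_mul_density [CompactSpace M] (S : AlmostHermitian M) (he : e ∈ atlas R4 M)
    (hc : Continuous h) (hh : tsupport h ⊆ e.source) :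
    IntegrableOn (fun y => h (e.symm y) * density (S.metricMatrix e) y) e.target :=
  (integrable_indicator_iff e.open_target.measurableSet).1
    ((S.continuous_indicator_mul_density he hc hh).integrable_of_hasCompactSupport
      (hasCompactSupport_indicator hh _))

theorem chartIntegral_sum [CompactSpace M] (S : AlmostHermitian M) (he : e ∈ atlas R4 M)
    {ι : Type*} (s : Finset ι) {u : ι → M → ℝ} (hc : ∀ j ∈ s, Continuous (u j))
    (hu : ∀ j ∈ s, tsupport (u j) ⊆ e.source) :
    S.chartIntegral e (fun x => ∑ j ∈ s, u j x) = ∑ j ∈ s, S.chartIntegral e (u j) := by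
  simp only [chartIntegral, Finset.sum_mul]
  exact integral_finsetSum _ fun j hj => S.integrableOn_mul_density he (hc j hj) (hu j hj)

theorem chartIntegral_eq_setIntegral_overlap (S : AlmostHermitian M)
    (hh : Function.support h ⊆ e'.source) :
    S.chartIntegral e h = ∫ y in overlap e e', h (e.symm y) * density (S.metricMatrix e) y := by
  refine setIntegral_eq_of_subset_of_forall_sdiff_eq_zero e.open_target.measurableSet
    Set.inter_subset_left fun y hy => ?_
  by_contra hne
  exact hy.2 ⟨hy.1, hh (left_ne_zero_of_mul hne)⟩

theorem chartIntegral_eq (S : AlmostHermitian M) (he : e ∈ atlas R4 M) (he' : e' ∈ atlas R4 M)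
    (hh : Function.support h ⊆ e.source) (hh' : Function.support h ⊆ e'.source) :
    S.chartIntegral e h = S.chartIntegral e' h := by
  have measurable_overlap := (isOpen_overlap e e').measurableSet
  rw [S.chartIntegral_eq_setIntegral_overlap hh', S.chartIntegral_eq_setIntegral_overlap hh,
    ← image_transition_overlap e e', integral_image_eq_integral_abs_det_fderiv_smul volume
      measurable_overlap (fun y hy =>
        (differentiableAt_transition he he' hy).hasFDerivAt.hasFDerivWithinAt)
      (injOn_transition e e')]
  refine setIntegral_congr_fun measurable_overlap fun y hy => ?_
  have det_eq : (fderiv ℝ (transition e e') y).det = (jacobian (transition e e') y).det := by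
    rw [← stdMatrix_fderiv (differentiableAt_transition he he' hy), stdMatrix,
      LinearMap.det_toMatrix]
  have base_eq : e'.symm (transition e e' y) = e.symm y := e'.left_inv hy.2
  simp only [(S.isCoordChange he he').density_eq hy, det_eq, base_eq, smul_eq_mul]
  ring

theorem chartIntegral_nonneg (S : AlmostHermitian M) (he : e ∈ atlas R4 M) (h0 : ∀ x, 0 ≤ h x) :
    0 ≤ S.chartIntegral e h :=
  setIntegral_nonneg e.open_target.measurableSet fun _ hy =>
    mul_nonneg (h0 _) ((S.isHermitianOn he).density_pos hy).le

theorem eq_zero_of_chartIntegral_eq_zero [CompactSpace M] (S : AlmostHermitian M)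
    (he : e ∈ atlas R4 M) (hc : Continuous h) (hh : tsupport h ⊆ e.source) (h0 : ∀ x, 0 ≤ h x)
    (hint : S.chartIntegral e h = 0) (x : M) : h x = 0 := by
  by_contra hne
  have density_pos : ∀ y ∈ e.target, 0 < density (S.metricMatrix e) y :=
    fun y hy => (S.isHermitianOn he).density_pos hy
  have hx : x ∈ e.source := hh (subset_tsupport h hne)
  have integral_pos := (S.continuous_indicator_mul_density he hc hh)
    |>.integral_pos_of_hasCompactSupport_nonneg_nonzero (μ := volume) (x := e x)
      (hasCompactSupport_indicator hh _)
      (fun y => Set.indicator_nonneg (fun z hz => mul_nonneg (h0 _) (density_pos z hz).le) y)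
      (by
        rw [Set.indicator_of_mem (e.map_source hx), e.left_inv hx]
        exact mul_ne_zero hne (density_pos _ (e.map_source hx)).ne')
  rw [integral_indicator e.open_target.measurableSet] at integral_pos
  exact integral_pos.ne' hint

/-- The contraction `⟨β, ω⟩` in the chart `e`. -/
def chartBeta (S : AlmostHermitian M) (e : OpenPartialHomeomorph M R4) : R4 → ℝ :=
  contr (S.metricMatrix e) (S.complexMatrix e) (betaForm (S.metricMatrix e) (S.complexMatrix e))

/-- The contraction `⟨ρ, ω⟩` in the chart `e`. -/
def chartRho (S : AlmostHermitian M) (e : OpenPartialHomeomorph M R4) : R4 → ℝ :=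
  contr (S.metricMatrix e) (S.complexMatrix e) (rhoForm (S.metricMatrix e) (S.complexMatrix e))

/-- The derivative of `v` along the Lee vector field, in the chart `e`. -/
def chartLeeDeriv (S : AlmostHermitian M) (v : M → ℝ) (e : OpenPartialHomeomorph M R4)
    (y : R4) : ℝ :=
  dirDeriv (leeVec (S.metricMatrix e) (S.complexMatrix e) y) (fun z => v (e.symm z)) y

theorem chartCompatible_chartBeta (S : AlmostHermitian M) : ChartCompatible S.chartBeta :=
  fun _ he _ he' _ hy =>
    (S.isCoordChange he he').contr_eq hy ((S.isCoordChange he he').betaForm_eq hy)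

theorem chartCompatible_chartRho (S : AlmostHermitian M) : ChartCompatible S.chartRho :=
  fun _ he _ he' _ hy =>
    (S.isCoordChange he he').contr_eq hy ((S.isCoordChange he he').rhoForm_eq hy)

theorem contDiffOn_comp_symm (hv : ContMDiff 𝓘(ℝ, R4) 𝓘(ℝ) ∞ v) (he : e ∈ atlas R4 M) :
    ContDiffOn ℝ ∞ (fun z => v (e.symm z)) e.target :=
  contMDiffOn_iff_contDiffOn.1
    (hv.comp_contMDiffOn (contMDiffOn_symm_of_mem_maximalAtlas (mem_maximalAtlas he)))

theorem chartCompatible_chartLeeDeriv (S : AlmostHermitian M)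
    (hv : ContMDiff 𝓘(ℝ, R4) 𝓘(ℝ) ∞ v) : ChartCompatible (S.chartLeeDeriv v) := by
  intro e he e' he' y hy
  have diff_v := differentiableAt_of_contDiffOn e'.open_target (contDiffOn_comp_symm hv he')
    (e'.map_source hy.2)
  refine Eq.trans ?_ ((S.isCoordChange he he').dirDeriv_leeVec_eq diff_v hy)
  refine dirDeriv_congr (isOpen_overlap e e') hy fun z hz => ?_
  rw [transition, e'.left_inv hz.2]

/-- The contraction `⟨β, ω⟩`. -/
def betaTrace (S : AlmostHermitian M) : M → ℝ := glue S.chartBeta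

/-- The contraction `⟨ρ, ω⟩`. -/
def rhoTrace (S : AlmostHermitian M) : M → ℝ := glue S.chartRho

/-- The derivative of `v` along the Lee vector field. -/
def leeDeriv (S : AlmostHermitian M) (v : M → ℝ) : M → ℝ := glue (S.chartLeeDeriv v)

theorem contMDiff_betaTrace (S : AlmostHermitian M) : ContMDiff 𝓘(ℝ, R4) 𝓘(ℝ) ∞ S.betaTrace :=
  S.chartCompatible_chartBeta.contMDiff_glue fun _ he =>
    (S.isHermitianOn he).smooth_contr (S.isHermitianOn he).smooth_betaForm

theorem contMDiff_rhoTrace (S : AlmostHermitian M) : ContMDiff 𝓘(ℝ, R4) 𝓘(ℝ) ∞ S.rhoTrace :=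
  S.chartCompatible_chartRho.contMDiff_glue fun _ he =>
    (S.isHermitianOn he).smooth_contr (S.isHermitianOn he).smooth_rhoForm

theorem contMDiff_leeDeriv (S : AlmostHermitian M) (hv : ContMDiff 𝓘(ℝ, R4) 𝓘(ℝ) ∞ v) :
    ContMDiff 𝓘(ℝ, R4) 𝓘(ℝ) ∞ (S.leeDeriv v) :=
  (S.chartCompatible_chartLeeDeriv hv).contMDiff_glue fun e he =>
    smooth_dirDeriv e.open_target (S.isHermitianOn he).smooth_leeVec (contDiffOn_comp_symm hv he)

theorem leeDeriv_sum (S : AlmostHermitian M) {ι : Type*} (s : Finset ι) {u : ι → M → ℝ}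
    (hu : ∀ j ∈ s, ContMDiff 𝓘(ℝ, R4) 𝓘(ℝ) ∞ (u j)) (x : M) :
    S.leeDeriv (fun x => ∑ j ∈ s, u j x) x = ∑ j ∈ s, S.leeDeriv (u j) x :=
  dirDeriv_sum s _ fun j hj => differentiableAt_of_contDiffOn (chartAt R4 x).open_target
    (contDiffOn_comp_symm (hu j hj) (chart_mem_atlas R4 x)) (mem_chart_target R4 x)

theorem leeDeriv_eq_zero_of_notMem_tsupport (S : AlmostHermitian M) {x : M}
    (hx : x ∉ tsupport v) : S.leeDeriv v x = 0 := by
  have isOpen_compl : IsOpen ((chartAt R4 x).target ∩ (chartAt R4 x).symm ⁻¹' (tsupport v)ᶜ) :=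
    (chartAt R4 x).symm.isOpen_inter_preimage (isClosed_tsupport v).isOpen_compl
  refine (dirDeriv_congr (h := fun _ => 0) isOpen_compl ⟨mem_chart_target R4 x, ?_⟩
    fun z hz => image_eq_zero_of_notMem_tsupport hz.2).trans (dirDeriv_const _ _)
  rwa [Set.mem_preimage, (chartAt R4 x).left_inv (mem_chart_source R4 x)]

/-- The divergence of `v` times the Lee vector field, by the formula `X v + ¼ ⟨β, ω⟩ v` which is
valid in the class `AH₁`, where `δθ = -¼ ⟨β, ω⟩`. -/
def leeDivergence (S : AlmostHermitian M) (v : M → ℝ) (x : M) : ℝ :=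
  S.leeDeriv v x + 1 / 4 * (v x * S.betaTrace x)

theorem continuous_leeDivergence (S : AlmostHermitian M) (hv : ContMDiff 𝓘(ℝ, R4) 𝓘(ℝ) ∞ v) :
    Continuous (S.leeDivergence v) :=
  (S.contMDiff_leeDeriv hv).continuous.add
    (continuous_const.mul (hv.continuous.mul S.contMDiff_betaTrace.continuous))

theorem leeDivergence_sum (S : AlmostHermitian M) {ι : Type*} (s : Finset ι) {u : ι → M → ℝ}
    (hu : ∀ j ∈ s, ContMDiff 𝓘(ℝ, R4) 𝓘(ℝ) ∞ (u j)) (x : M) :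
    S.leeDivergence (fun x => ∑ j ∈ s, u j x) x = ∑ j ∈ s, S.leeDivergence (u j) x := by
  simp only [leeDivergence, S.leeDeriv_sum s hu, Finset.sum_add_distrib, Finset.sum_mul,
    Finset.mul_sum]

theorem tsupport_leeDivergence_subset (S : AlmostHermitian M) (v : M → ℝ) :
    tsupport (S.leeDivergence v) ⊆ tsupport v := by
  refine closure_minimal (fun x hx => ?_) (isClosed_tsupport v)
  by_contra hn
  refine hx ?_
  rw [leeDivergence, S.leeDeriv_eq_zero_of_notMem_tsupport hn,
    image_eq_zero_of_notMem_tsupport hn, zero_mul, mul_zero, add_zero]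

theorem IsAH1.isGrayOn (hS : S.IsAH1) (he : e ∈ atlas R4 M) :
    IsGrayOn (S.metricMatrix e) (S.complexMatrix e) e.target :=
  (S.isHermitianOn he).isGrayOn fun y hy i j k l => hS e he y hy i j k l

theorem IsAH1.chartIntegral_leeDivergence [CompactSpace M] (hS : S.IsAH1) (he : e ∈ atlas R4 M)
    (hv : ContMDiff 𝓘(ℝ, R4) 𝓘(ℝ) ∞ v) (hsupp : tsupport v ⊆ e.source) :
    S.chartIntegral e (S.leeDivergence v) = 0 := by
  have hH := S.isHermitianOn he
  have smooth_v := contDiffOn_comp_symm hv he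
  rw [← setIntegral_sum_pderiv_eq_zero e.open_target
    (fun k => smooth_v.mul (hH.smooth_density.mul (hH.smooth_leeVec k)))
    (fun k => hasCompactSupport_indicator hsupp _)
    (fun k => tsupport_indicator_subset_target hsupp _)]
  refine setIntegral_congr_fun e.open_target.measurableSet fun y hy => ?_
  rw [hH.sum_pderiv_mul_density_mul_leeVec smooth_v hy, (hS.isGrayOn he).codiffOne_leeForm hy,
    leeDivergence, leeDeriv, (S.chartCompatible_chartLeeDeriv hv).glue_symm he hy, betaTrace,
    S.chartCompatible_chartBeta.glue_symm he hy, chartLeeDeriv, chartBeta]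
  ring

end AlmostHermitian

/-- A smooth partition of unity on a compact manifold, subordinate to finitely many of the
preferred charts. It serves to integrate functions over the manifold. -/
structure ChartPartition (M : Type*) [TopologicalSpace M] [ChartedSpace R4 M] where
  /-- The points whose preferred charts are used. -/
  centers : Finset M
  /-- The functions of the partition. -/
  weight : SmoothPartitionOfUnity centers 𝓘(ℝ, R4) M Set.univ
  isSubordinate : weight.IsSubordinate fun i => (chartAt R4 (i : M)).source

theorem nonempty_chartPartition (M : Type*) [TopologicalSpace M] [T2Space M] [CompactSpace M]
    [ChartedSpace R4 M] [IsManifold 𝓘(ℝ, R4) ∞ M] : Nonempty (ChartPartition M) := by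
  obtain ⟨centers, cover⟩ := isCompact_univ.elim_finite_subcover
    (fun x : M => (chartAt R4 x).source) (fun x => (chartAt R4 x).open_source)
    fun x _ => Set.mem_iUnion.2 ⟨x, mem_chart_source R4 x⟩
  obtain ⟨weight, isSubordinate⟩ := SmoothPartitionOfUnity.exists_isSubordinate 𝓘(ℝ, R4)
    isClosed_univ (fun i : centers => (chartAt R4 (i : M)).source)
    (fun i => (chartAt R4 (i : M)).open_source)
    fun x hx => by
      obtain ⟨i, hi, hxi⟩ := Set.mem_iUnion₂.1 (cover hx)
      exact Set.mem_iUnion.2 ⟨⟨i, hi⟩, hxi⟩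
  exact ⟨⟨centers, weight, isSubordinate⟩⟩

namespace ChartPartition

open AlmostHermitian Coord MeasureTheory

variable {M : Type*} [TopologicalSpace M] [ChartedSpace R4 M] (p : ChartPartition M)

/-- The chart whose domain carries the `i`-th function of the partition. -/
def chart (i : p.centers) : OpenPartialHomeomorph M R4 := chartAt R4 (i : M)

theorem chart_mem (i : p.centers) : p.chart i ∈ atlas R4 M := chart_mem_atlas R4 _

theorem sum_weight (x : M) : ∑ i, p.weight i x = 1 := by
  rw [← finsum_eq_sum_of_fintype]
  exact p.weight.sum_eq_one (Set.mem_univ x)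

theorem sum_weight_mul (h : M → ℝ) (x : M) : ∑ i, p.weight i x * h x = h x := by
  rw [← Finset.sum_mul, p.sum_weight, one_mul]

theorem tsupport_weight_mul_subset (i : p.centers) (h : M → ℝ) :
    tsupport (fun x => p.weight i x * h x) ⊆ (p.chart i).source :=
  (tsupport_mul_subset_left (f := p.weight i) (g := h)).trans (p.isSubordinate i)

theorem continuous_weight_mul (i : p.centers) {h : M → ℝ} (hc : Continuous h) :
    Continuous fun x => p.weight i x * h x :=
  (p.weight i).contMDiff.continuous.mul hc

variable [IsManifold 𝓘(ℝ, R4) ∞ M]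

/-- The integral of a function over the manifold, against the Riemannian volume. -/
def integral (S : AlmostHermitian M) (h : M → ℝ) : ℝ :=
  ∑ i, S.chartIntegral (p.chart i) fun x => p.weight i x * h x

variable [CompactSpace M] (S : AlmostHermitian M) {h v : M → ℝ}

theorem integral_sum {ι : Type*} (s : Finset ι) {u : ι → M → ℝ}
    (hc : ∀ j ∈ s, Continuous (u j)) :
    p.integral S (fun x => ∑ j ∈ s, u j x) = ∑ j ∈ s, p.integral S (u j) := by
  simp only [integral, Finset.mul_sum]
  rw [Finset.sum_comm]
  exact Finset.sum_congr rfl fun i _ => S.chartIntegral_sum (p.chart_mem i) s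
    (fun j hj => p.continuous_weight_mul i (hc j hj))
    fun j _ => p.tsupport_weight_mul_subset i (u j)

theorem integral_eq_chartIntegral (j : p.centers) (hc : Continuous h)
    (hh : tsupport h ⊆ (p.chart j).source) :
    p.integral S h = S.chartIntegral (p.chart j) h := by
  have change_chart : ∀ i, S.chartIntegral (p.chart i) (fun x => p.weight i x * h x) =
      S.chartIntegral (p.chart j) fun x => p.weight i x * h x := fun i =>
    S.chartIntegral_eq (p.chart_mem i) (p.chart_mem j)
      (subset_closure.trans (p.tsupport_weight_mul_subset i h))
      fun x hx => hh (subset_closure (right_ne_zero_of_mul hx))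
  rw [integral, Finset.sum_congr rfl fun i _ => change_chart i,
    ← S.chartIntegral_sum (p.chart_mem j) _ (fun i _ => p.continuous_weight_mul i hc)
      fun i _ => (tsupport_mul_subset_right (f := p.weight i) (g := h)).trans hh]
  simp only [p.sum_weight_mul]

variable {S}

theorem integral_leeDivergence (hS : S.IsAH1) (hv : ContMDiff 𝓘(ℝ, R4) 𝓘(ℝ) ∞ v) :
    p.integral S (S.leeDivergence v) = 0 := by
  have smooth_piece : ∀ i, ContMDiff 𝓘(ℝ, R4) 𝓘(ℝ) ∞ fun x => p.weight i x * v x :=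
    fun i => (p.weight i).contMDiff.mul hv
  have decomposition : S.leeDivergence v =
      fun x => ∑ i, S.leeDivergence (fun x => p.weight i x * v x) x := by
    funext x
    rw [← S.leeDivergence_sum _ (fun i _ => smooth_piece i)]
    simp only [p.sum_weight_mul]
  rw [decomposition, p.integral_sum S _ fun i _ => S.continuous_leeDivergence (smooth_piece i)]
  refine Finset.sum_eq_zero fun i _ => ?_
  rw [p.integral_eq_chartIntegral S i (S.continuous_leeDivergence (smooth_piece i))
    ((S.tsupport_leeDivergence_subset _).trans (p.tsupport_weight_mul_subset i v))]
  exact hS.chartIntegral_leeDivergence (p.chart_mem i) (smooth_piece i)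
    (p.tsupport_weight_mul_subset i v)

theorem eq_zero_of_integral_eq_zero (hc : Continuous h) (h0 : ∀ x, 0 ≤ h x)
    (hint : p.integral S h = 0) (x : M) : h x = 0 := by
  have piece_nonneg : ∀ i x, 0 ≤ p.weight i x * h x :=
    fun i x => mul_nonneg (p.weight.nonneg i x) (h0 x)
  have piece_integral : ∀ i, S.chartIntegral (p.chart i) (fun x => p.weight i x * h x) = 0 :=
    fun i => (Finset.sum_eq_zero_iff_of_nonneg fun i _ =>
      S.chartIntegral_nonneg (p.chart_mem i) (piece_nonneg i)).1 hint i (Finset.mem_univ i)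
  rw [← p.sum_weight_mul h x]
  exact Finset.sum_eq_zero fun i _ => S.eq_zero_of_chartIntegral_eq_zero (p.chart_mem i)
    (p.continuous_weight_mul i hc) (p.tsupport_weight_mul_subset i h) (piece_nonneg i)
    (piece_integral i) x

end ChartPartition

namespace AlmostHermitian

open Coord

variable {M : Type*} [TopologicalSpace M] [ChartedSpace R4 M] [IsManifold 𝓘(ℝ, R4) ∞ M]
  {S : AlmostHermitian M}

theorem IsAH1.rhoTrace_ne_zero (hS : S.IsAH1)
    (hs : ∀ e ∈ atlas R4 M, ∀ y ∈ e.target, S.scalarCurvature e y ≠ 0) (x : M) :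
    S.rhoTrace x ≠ 0 := by
  have he := chart_mem_atlas R4 x
  have hx := mem_chart_target R4 x
  exact ((hS.isGrayOn he).contr_rhoForm hx).trans_ne (mul_ne_zero (by norm_num) (hs _ he _ hx))

/-- The quotient `⟨β, ω⟩ / |⟨ρ, ω⟩|`, which is constant along the Lee vector field. -/
def traceQuotient (S : AlmostHermitian M) (x : M) : ℝ :=
  S.betaTrace x / |S.rhoTrace x|

theorem contMDiff_traceQuotient (hr : ∀ x, S.rhoTrace x ≠ 0) :
    ContMDiff 𝓘(ℝ, R4) 𝓘(ℝ) ∞ S.traceQuotient :=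
  S.contMDiff_betaTrace.div₀
    (fun x => (contDiffAt_abs (hr x)).contMDiffAt.comp x (S.contMDiff_rhoTrace x))
    fun x => abs_ne_zero.2 (hr x)

theorem IsAH1.leeDeriv_traceQuotient (hS : S.IsAH1) (hr : ∀ x, S.rhoTrace x ≠ 0) (x : M) :
    S.leeDeriv S.traceQuotient x = 0 := by
  have he := chart_mem_atlas R4 x
  have hx := mem_chart_target R4 x
  have hH := S.isHermitianOn he
  have hG := hS.isGrayOn he
  have rho_ne : S.chartRho (chartAt R4 x) (chartAt R4 x x) ≠ 0 := hr x
  refine (dirDeriv_congr (chartAt R4 x).open_target hx fun z hz => ?_).trans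
    (dirDeriv_div_abs_eq_zero
      (differentiableAt_of_contDiffOn (chartAt R4 x).open_target
        (hH.smooth_contr hH.smooth_betaForm) hx)
      (differentiableAt_of_contDiffOn (chartAt R4 x).open_target
        (hH.smooth_contr hH.smooth_rhoForm) hx)
      rho_ne (hG.contr_rhoForm_mul_dirDeriv hx rho_ne))
  rw [traceQuotient, betaTrace, S.chartCompatible_chartBeta.glue_symm he hz, rhoTrace,
    S.chartCompatible_chartRho.glue_symm he hz]
  rfl

theorem IsAH1.betaTrace_eq_zero [CompactSpace M] (hS : S.IsAH1) (p : ChartPartition M)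
    (hr : ∀ x, S.rhoTrace x ≠ 0) (x : M) : S.betaTrace x = 0 := by
  have smooth_quotient := contMDiff_traceQuotient hr
  have divergence_eq : ∀ x, S.leeDivergence S.traceQuotient x =
      1 / 4 * (S.betaTrace x ^ 2 / |S.rhoTrace x|) := fun x => by
    rw [leeDivergence, hS.leeDeriv_traceQuotient hr, traceQuotient]
    ring
  have divergence_zero := p.eq_zero_of_integral_eq_zero
    (S.continuous_leeDivergence smooth_quotient) (fun x => by rw [divergence_eq]; positivity)
    (p.integral_leeDivergence hS smooth_quotient) x
  simpa only [divergence_eq, mul_eq_zero, div_eq_zero_iff, one_ne_zero, OfNat.ofNat_ne_zero,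
    or_self, false_or, abs_eq_zero, hr x, or_false, ne_eq, not_false_eq_true, pow_eq_zero_iff]
    using divergence_zero

end AlmostHermitian

end

theorem proposition5p4 {M : Type*} [TopologicalSpace M] [T2Space M] [CompactSpace M]
    [ChartedSpace R4 M] [IsManifold 𝓘(ℝ, R4) ∞ M] (S : AlmostHermitian M) (hAH1 : S.IsAH1)
    (hs : ∀ e ∈ atlas R4 M, ∀ y ∈ e.target, S.scalarCurvature e y ≠ 0) :
    ∀ e ∈ atlas R4 M, ∀ y ∈ e.target, S.codiffLee e y = 0 := by
  intro e he y hy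
  obtain ⟨p⟩ := nonempty_chartPartition M
  have betaTrace_zero : S.betaTrace (e.symm y) = 0 :=
    hAH1.betaTrace_eq_zero p (hAH1.rhoTrace_ne_zero hs) (e.symm y)
  calc S.codiffLee e y = -(1 / 4) * S.chartBeta e y := (hAH1.isGrayOn he).codiffOne_leeForm hy
    _ = -(1 / 4) * S.betaTrace (e.symm y) := by
      rw [AlmostHermitian.betaTrace, S.chartCompatible_chartBeta.glue_symm he hy]
    _ = 0 := by rw [betaTrace_zero, mul_zero]
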